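/- **Moment problems.** Let $\mathbb Z_+=\{0,1,2,\dots\}$ and let $\{a_{m,n}\}_{m,n\in\mathbb Z_+}$ be complex numbers. The complex moment problem asks for a non-negative Borel measure $\sigma$ on $\mathbb C$ with $\int_{\mathbb C}z^m\bar z^n\,d\sigma=a_{m,n}$ for all $m,n\in\mathbb Z_+$. The two-dimensional moment problem with moments $s_{m,n}$ asks for a non-negative Borel measure $\mu$ on $\mathbb R^2$ with $\int_{\mathbb R^2}x_1^mx_2^n\,d\mu=s_{m,n}$ for all $m,n\in\mathbb Z_+$. (Being a solution includes integrability of the functions involved.) Let $s_{m,n}$ be defined by $$s_{m,n}=\frac1{2^m(2i)^n}\sum_{k=0}^m\sum_{j=0}^n(-1)^{n-j}\binom mk\binom nj a_{k+j,\,m-k+n-j}.\tag{4.5}$$ For a measure $\mu$ on $\mathbb R^2$ let $\sigma_\mu$ be the same measure viewed on $\mathbb C$, i.e. its image under $(x_1,x_2)\mapsto x_1+ix_2$. Let $\Omega=\{(m,k,l;n,r,t): m,n\in\mathbb Z_+,\ k,l,r,t\in\mathbb Z\}$, let $\Omega_0\subset\Omega$ be given by $k=l=r=t=0$, and $\Omega'=\Omega\setminus\Omega_0$.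 For $p=(m,k,l;n,r,t)$ and $p'=(m',k',l';n',r',t')$ put $y_p(x)=x_1^m(x_1+i)^k(x_1-i)^lx_2^n(x_2+i)^r(x_2-i)^t$ and $p\circ p'=(m+m',k+l',l+k';n+n',r+t',t+r')$. The extended moment problem with moments $\{u_p\}_{p\in\Omega}$ asks for a non-negative Borel measure $\mu$ on $\mathbb R^2$ with $\int y_p\,d\mu=u_p$ for all $p\in\Omega$. **Model space.** A model space is a complex Hilbert space $\mathcal H$ (scalar product linear in the first argument) with elements $h_{m,n}$ $(m,n\in\mathbb Z_+)$ satisfying $(h_{m,n},h_{m',n'})=s_{m+m',n+n'}$ and orthonormal vectors $e_0,e_1,\dots$ orthogonal to all $h_{m,n}$, such that $\mathcal H=\mathcal H_0\oplus\bigoplus_{j\ge0}\mathbb C e_j$, where $\mathcal H_0$ is the closed linear span of the $h_{m,n}$. Fix an arbitrary model space, a bijection $w:\mathbb Z_+\to\Omega'$, the orthonormal basis $\{g_n\}$ of $\mathcal H_0$ obtained by the Gram–Schmidt procedure from the $h_{m,n}$ listed in some arbitrary order, and constants $M_j>0$ such that $\int|y_{w(j)}|^2d\mu\le M_j$ for every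 solution $\mu$ of the two-dimensional moment problem with moments $s_{m,n}$. **Equations.** For a family $\{h_p\}_{p\in\Omega}$ in $\mathcal H$ consider the following scalar equations, where only the displayed indices change: (a) $(h_{m+1}+ih_p,h_q)=(h_{k+1},h_q)$, $\ (h_{m+1}-ih_p,h_q)=(h_{l+1},h_q)$, $\ (h_{n+1}+ih_p,h_q)=(h_{r+1},h_q)$, $\ (h_{n+1}-ih_p,h_q)=(h_{t+1},h_q)$ for all $p=(m,k,l;n,r,t),\,q\in\Omega$; here e.g. $h_{k+1}$ means $h_{m,k+1,l;n,r,t}$; (b) $(h_p,h_{p'})=(h_{\tilde p},h_{\tilde p'})$, where $\tilde p,\tilde p'$ arise from $p,p'$ by replacing one of the pairs $(m,m')$, $(k,l')$, $(l,k')$, $(n,n')$, $(r,t')$, $(t,r')$ (the first entry belonging to $p$, the second to $p'$) by an admissible pair with the same sum. **Algorithm.** *Step 0.* Put $h_{m,0,0;n,0,0}=h_{m,n}$. *Step for $r\ge0$.* Let $G_0$ consist of the empty tuple, and let $G_{r+1}$ be the set of all tuples $(h_{w(0)},\dots,h_{w(r)})$ such that $(h_{w(0)},\dots,h_{w(r-1)})\in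 G_r$, $$h_{w(r)}=\sum_n\alpha_ng_n+\sum_{j<r}\beta_je_j+\Bigl(d-\sum_n|\alpha_n|^2-\sum_{j<r}|\beta_j|^2\Bigr)^{1/2}e_r$$ for some $\alpha_n,\beta_j\in\mathbb C$ and $d\in\mathbb R$ with $\sum_n|\alpha_n|^2+\sum_{j<r}|\beta_j|^2\le d\le M_r$, and all equations (a), (b) that contain $h_{w(r)}$ and otherwise only elements with indices in $\Omega_0\cup\{w(0),\dots,w(r)\}$ hold. *Final step.* Let $\mathbf G$ be the set of all sequences $\mathbf g=(g^{(0)},g^{(1)},\dots)$ in $\mathcal H$ with $\sup_j\|g^{(j)}\|/\sqrt{M_j}<\infty$ such that for every $r\ge1$: $(g^{(0)},\dots,g^{(r-1)})\in G_r$ and $\|g^{(j)}\|\le\sqrt{M_j}$ for $j\ge r$. For $\mathbf g\in\mathbf G$ let $\mathfrak H(\mathbf g)=\{h_p\}_{p\in\Omega}$ be the family with $h_{m,0,0;n,0,0}=h_{m,n}$ and $h_{w(j)}=g^{(j)}$. Let $X(\mathcal H)$ be the set of families $\{h_p\}_{p\in\Omega}$ in $\mathcal H$ such that 1) $h_{m,0,0;n,0,0}=h_{m,n}$;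 2) for some $\Lambda\subset\mathbb Z_+$ and all $r\ge 0$, $h_{w(r)}\in\mathcal H_0\oplus\bigoplus_{j\in\Lambda,\,j\le r}\mathbb Ce_j$ and $(h_{w(r)},e_r)\ge0$; 3) $h_{m+1}+ih_p=h_{k+1}$, $h_{m+1}-ih_p=h_{l+1}$, $h_{n+1}+ih_p=h_{r+1}$, $h_{n+1}-ih_p=h_{t+1}$ for all $p\in\Omega$ (notation as in (a)); 4) there is a function $\varphi:\Omega\to\mathbb C$ with $(h_p,h_{p'})=\varphi(p\circ p')$ for all $p,p'\in\Omega$. **Theorem 4.2.** Assume that (i) $\sum\alpha_{m,n}\overline{\alpha_{m',n'}}\,s_{m+m',n+n'}\ge0$ for all finitely supported complex $\{\alpha_{m,n}\}$; (ii) all equations (a), (b) in which only indices from $\Omega_0$ occur hold for $h_{m,0,0;n,0,0}=h_{m,n}$; (iii) $\mathbf G\ne\emptyset$; (iv) for all $m,n\in\mathbb Z_+$, $$a_{m,n}=\sum_{r=0}^m\sum_{l=0}^n\binom mr\binom nl(-1)^{n-l}i^{\,m-r+n-l}s_{r+l,\,m-r+n-l}.\tag{4.4}$$ Let $\Psi$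 be the set of all solutions of the complex moment problem and $\Phi$ the set of all solutions of the two-dimensional moment problem with the moments $s_{m,n}$ from (4.5). Then $$\Psi=\{\sigma_\mu:\mu\in\Phi\}.$$ Moreover, $\Psi$ is described by the algorithm: for every $\mathbf g\in\mathbf G$ the family $\mathfrak H(\mathbf g)$ belongs to $X(\mathcal H)$; with $\varphi$ as in 4) for this family, the extended moment problem with moments $\varphi$ has a unique solution $\mu_{\mathbf g}$; one has $\mu_{\mathbf g}\in\Phi$ and $\sigma_{\mu_{\mathbf g}}\in\Psi$; and $\Psi=\{\sigma_{\mu_{\mathbf g}}:\mathbf g\in\mathbf G\}$. -/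

import Mathlib

namespace MomentProblem

noncomputable section

/-! ### The moment problems -/

/-- `μ` is a solution of the two-dimensional moment problem `∫ x₁ᵐ x₂ⁿ dμ = s m n`
(all monomials are `μ`-integrable). -/
def IsPlaneSolution (s : ℕ → ℕ → ℂ) (μ : MeasureTheory.Measure (ℝ × ℝ)) : Prop :=
  ∀ m n : ℕ,
    MeasureTheory.Integrable (fun x : ℝ × ℝ => (x.1 : ℂ) ^ m * (x.2 : ℂ) ^ n) μ ∧
      ∫ x : ℝ × ℝ, (x.1 : ℂ) ^ m * (x.2 : ℂ) ^ n ∂μ = s m n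

/-- `σ` is a solution of the complex moment problem `∫ zᵐ z̄ⁿ dσ = a m n`. -/
def IsComplexSolution (a : ℕ → ℕ → ℂ) (σ : MeasureTheory.Measure ℂ) : Prop :=
  ∀ m n : ℕ,
    MeasureTheory.Integrable (fun z : ℂ => z ^ m * (starRingEnd ℂ z) ^ n) σ ∧
      ∫ z : ℂ, z ^ m * (starRingEnd ℂ z) ^ n ∂σ = a m n

/-- A measure on `ℝ²` viewed as a measure on `ℂ` through `z = x₁ + i x₂`. -/
def toComplexMeasure (μ : MeasureTheory.Measure (ℝ × ℝ)) : MeasureTheory.Measure ℂ :=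
  μ.map (fun x : ℝ × ℝ => (x.1 : ℂ) + (x.2 : ℂ) * Complex.I)

/-- The moments `s_{m,n}` in the plane computed from the complex moments `a_{m,n}`. -/
def planeMoments (a : ℕ → ℕ → ℂ) (m n : ℕ) : ℂ :=
  1 / ((2 : ℂ) ^ m * (2 * Complex.I) ^ n) *
    ∑ k ∈ Finset.range (m + 1), ∑ j ∈ Finset.range (n + 1),
      (-1 : ℂ) ^ (n - j) * (m.choose k : ℂ) * (n.choose j : ℂ) * a (k + j) (m - k + (n - j))

/-- The complex moments computed from the moments `s_{m,n}` in the plane. -/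
def complexMoments (s : ℕ → ℕ → ℂ) (m n : ℕ) : ℂ :=
  ∑ r ∈ Finset.range (m + 1), ∑ l ∈ Finset.range (n + 1),
    (m.choose r : ℂ) * (n.choose l : ℂ) * (-1 : ℂ) ^ (n - l) * Complex.I ^ (m - r + (n - l)) *
      s (r + l) (m - r + (n - l))

/-- Positivity: `∑ α_{m,n} conj(α_{m',n'}) s_{m+m',n+n'} ≥ 0` for all finitely supported `α`
(the sum is real and non-negative). -/
def IsPositive (s : ℕ → ℕ → ℂ) : Prop :=
  ∀ α : ℕ × ℕ →₀ ℂ,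
    0 ≤ (∑ p ∈ α.support, ∑ q ∈ α.support,
        α p * starRingEnd ℂ (α q) * s (p.1 + q.1) (p.2 + q.2)).re ∧
      (∑ p ∈ α.support, ∑ q ∈ α.support,
        α p * starRingEnd ℂ (α q) * s (p.1 + q.1) (p.2 + q.2)).im = 0

/-! ### The index set of the extended problem -/

/-- The index set `Ω` of all `(m,k,l;n,r,t)` with `m, n ∈ ℤ₊` and `k, l, r, t ∈ ℤ`. -/
structure Omega where
  m : ℕ
  k : ℤ
  l : ℤ
  n : ℕ
  r : ℤ
  t : ℤ

/-- The subset `Ω₀` of `Ω` given by `k = l = r = t = 0`. -/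
def OmegaZero : Set Omega := {p | p.k = 0 ∧ p.l = 0 ∧ p.r = 0 ∧ p.t = 0}

/-- The index of a Gram entry:
`(m,k,l;n,r,t), (m',k',l';n',r',t') ↦ (m+m',k+l',l+k';n+n',r+t',t+r')`. -/
def Omega.conjAdd (p q : Omega) : Omega :=
  ⟨p.m + q.m, p.k + q.l, p.l + q.k, p.n + q.n, p.r + q.t, p.t + q.r⟩

/-- The function `x₁ᵐ (x₁+i)ᵏ (x₁-i)ˡ x₂ⁿ (x₂+i)ʳ (x₂-i)ᵗ`. -/
def Omega.fn (p : Omega) (x : ℝ × ℝ) : ℂ :=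
  (x.1 : ℂ) ^ p.m * ((x.1 : ℂ) + Complex.I) ^ p.k * ((x.1 : ℂ) - Complex.I) ^ p.l *
    ((x.2 : ℂ) ^ p.n * ((x.2 : ℂ) + Complex.I) ^ p.r * ((x.2 : ℂ) - Complex.I) ^ p.t)

/-- `μ` is a solution of the extended two-dimensional moment problem with moments `u`. -/
def IsExtendedSolution (u : Omega → ℂ) (μ : MeasureTheory.Measure (ℝ × ℝ)) : Prop :=
  ∀ p : Omega, MeasureTheory.Integrable p.fn μ ∧ ∫ x : ℝ × ℝ, p.fn x ∂μ = u p

/-- An indexation `w` of `Ω' = Ω \ Ω₀` by the natural numbers (starting with `0`). -/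
abbrev Indexation : Type := ℕ ≃ {p : Omega // p ∉ OmegaZero}

/-- The constants `M_j > 0` are admissible for the moments `s` if they bound
`d_j = ∫ |x₁ᵐ (x₁+i)ᵏ (x₁-i)ˡ x₂ⁿ (x₂+i)ʳ (x₂-i)ᵗ|² dμ`, `(m,k,l;n,r,t) = w j`,
for every solution `μ` of the two-dimensional moment problem with these moments. -/
def IsAdmissibleBound (s : ℕ → ℕ → ℂ) (w : Indexation) (M : ℕ → ℝ) : Prop :=
  ∀ j : ℕ, 0 < M j ∧
    ∀ μ : MeasureTheory.Measure (ℝ × ℝ), IsPlaneSolution s μ →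
      ∫ x : ℝ × ℝ, ‖(w j).1.fn x‖ ^ 2 ∂μ ≤ M j

/-! ### Inner product equations -/

section Hilbert

variable {H : Type*} [NormedAddCommGroup H] [InnerProductSpace ℂ H]

/-- The scalar product `(x, y)`, linear in the first variable. -/
def ip (x y : H) : ℂ := inner ℂ y x

/-- The individual equations between scalar products of the elements of a family
`{h_{m,k,l;n,r,t}}`. The first four kinds express, tested against an element `h_a`, that
`h_{m+1,…} ± i h_{m,…}` equals the element with `k` (for `+`) or `l` (for `-`) raised by one, and
the same for `n` with `r` and `t`. The last six kinds say that a scalar product does not change when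
`m, m'` (or `k, l'`; `l, k'`; `n, n'`; `r, t'`; `t, r'`) are altered with their sum kept. -/
inductive GramEq : Type
  | shiftK (p a : Omega)
  | shiftL (p a : Omega)
  | shiftR (p a : Omega)
  | shiftT (p a : Omega)
  | moveM (p q : Omega) (m₁ m₁' : ℕ) (hsum : p.m + q.m = m₁ + m₁')
  | moveKL (p q : Omega) (k₁ l₁' : ℤ) (hsum : p.k + q.l = k₁ + l₁')
  | moveLK (p q : Omega) (l₁ k₁' : ℤ) (hsum : p.l + q.k = l₁ + k₁')
  | moveN (p q : Omega) (n₁ n₁' : ℕ) (hsum : p.n + q.n = n₁ + n₁')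
  | moveRT (p q : Omega) (r₁ t₁' : ℤ) (hsum : p.r + q.t = r₁ + t₁')
  | moveTR (p q : Omega) (t₁ r₁' : ℤ) (hsum : p.t + q.r = t₁ + r₁')

/-- The indices of the elements that occur in an equation. -/
def GramEq.indices : GramEq → Set Omega
  | shiftK p a => {{p with m := p.m + 1}, p, {p with k := p.k + 1}, a}
  | shiftL p a => {{p with m := p.m + 1}, p, {p with l := p.l + 1}, a}
  | shiftR p a => {{p with n := p.n + 1}, p, {p with r := p.r + 1}, a}
  | shiftT p a => {{p with n := p.n + 1}, p, {p with t := p.t + 1}, a}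
  | moveM p q m₁ m₁' _ => {p, q, {p with m := m₁}, {q with m := m₁'}}
  | moveKL p q k₁ l₁' _ => {p, q, {p with k := k₁}, {q with l := l₁'}}
  | moveLK p q l₁ k₁' _ => {p, q, {p with l := l₁}, {q with k := k₁'}}
  | moveN p q n₁ n₁' _ => {p, q, {p with n := n₁}, {q with n := n₁'}}
  | moveRT p q r₁ t₁' _ => {p, q, {p with r := r₁}, {q with t := t₁'}}
  | moveTR p q t₁ r₁' _ => {p, q, {p with t := t₁}, {q with r := r₁'}}

/-- The family `h` satisfies the equation. -/
def GramEq.Holds (h : Omega → H) : GramEq → Prop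
  | shiftK p a =>
      ip (h {p with m := p.m + 1} + Complex.I • h p) (h a) = ip (h {p with k := p.k + 1}) (h a)
  | shiftL p a =>
      ip (h {p with m := p.m + 1} - Complex.I • h p) (h a) = ip (h {p with l := p.l + 1}) (h a)
  | shiftR p a =>
      ip (h {p with n := p.n + 1} + Complex.I • h p) (h a) = ip (h {p with r := p.r + 1}) (h a)
  | shiftT p a =>
      ip (h {p with n := p.n + 1} - Complex.I • h p) (h a) = ip (h {p with t := p.t + 1}) (h a)
  | moveM p q m₁ m₁' _ => ip (h p) (h q) = ip (h {p with m := m₁}) (h {q with m := m₁'})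
  | moveKL p q k₁ l₁' _ => ip (h p) (h q) = ip (h {p with k := k₁}) (h {q with l := l₁'})
  | moveLK p q l₁ k₁' _ => ip (h p) (h q) = ip (h {p with l := l₁}) (h {q with k := k₁'})
  | moveN p q n₁ n₁' _ => ip (h p) (h q) = ip (h {p with n := n₁}) (h {q with n := n₁'})
  | moveRT p q r₁ t₁' _ => ip (h p) (h q) = ip (h {p with r := r₁}) (h {q with t := t₁'})
  | moveTR p q t₁ r₁' _ => ip (h p) (h q) = ip (h {p with t := t₁}) (h {q with r := r₁'})

/-- `φ` is a function on `Ω` with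
`(h_{m,k,l;n,r,t}, h_{m',k',l';n',r',t'}) = φ(m+m',k+l',l+k';n+n',r+t',t+r')`. -/
def IsGramFunction (h : Omega → H) (φ : Omega → ℂ) : Prop :=
  ∀ p q : Omega, ip (h p) (h q) = φ (p.conjAdd q)

end Hilbert

/-! ### Model spaces -/

/-- `H` as a model space for the two-dimensional moment problem with moments `s`: it is the
orthogonal sum of the closed linear span `H₀` of a sequence `h_{m,n}` with
`(h_{m,n}, h_{m',n'}) = s_{m+m',n+n'}` and of the one-dimensional spaces spanned by unit vectors
`e_j`, `j = 0, 1, 2, …`. -/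
structure ModelSpace (s : ℕ → ℕ → ℂ) (H : Type*) [NormedAddCommGroup H]
    [InnerProductSpace ℂ H] where
  h : ℕ → ℕ → H
  e : ℕ → H
  gram : ∀ m n m' n' : ℕ, ip (h m n) (h m' n') = s (m + m') (n + n')
  orthonormal : Orthonormal ℂ e
  orthogonal : ∀ j m n : ℕ, ip (e j) (h m n) = 0
  total : (Submodule.span ℂ (Set.range (fun p : ℕ × ℕ => h p.1 p.2) ∪ Set.range e)).topologicalClosure
    = ⊤

namespace ModelSpace

variable {s : ℕ → ℕ → ℂ} {H : Type*} [NormedAddCommGroup H] [InnerProductSpace ℂ H]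

/-- The closed subspace `H₀` spanned by the `h_{m,n}`. -/
def H₀ (S : ModelSpace s H) : Submodule ℂ H :=
  (Submodule.span ℂ (Set.range (fun p : ℕ × ℕ => S.h p.1 p.2))).topologicalClosure

open Classical in
/-- The family indexed by `Ω` with `h_{m,0,0;n,0,0} = h_{m,n}` and `h_{w(j)} = g_j`. -/
def family (S : ModelSpace s H) (w : Indexation) (g : ℕ → H) : Omega → H := fun p =>
  if hp : p ∈ OmegaZero then S.h p.m p.n else g (w.symm ⟨p, hp⟩)

/-- The set `X(H)` of the families in `H` such that
1) `h_{m,0,0;n,0,0} = h_{m,n}`;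
2) for some `Λ ⊆ ℕ`, each `h_{w(r)}` lies in the sum of `H₀` and of the lines spanned by `e_j`,
   `j ∈ Λ`, `j ≤ r`, and `(h_{w(r)}, e_r) ≥ 0`;
3) raising `k` or `l` (`r` or `t`) by one is the action of `h_{m+1,…} ± i h_{m,…}`
   (`h_{…;n+1,…} ± i h_{…;n,…}`);
4) the scalar products are given by a function on `Ω`. -/
structure IsExtension (S : ModelSpace s H) (w : Indexation) (h : Omega → H) : Prop where
  base : ∀ m n : ℕ, h ⟨m, 0, 0, n, 0, 0⟩ = S.h m n
  triangular : ∃ Λ : Set ℕ, ∀ r : ℕ,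
    h (w r).1 ∈ S.H₀ ⊔ Submodule.span ℂ (S.e '' {j | j ∈ Λ ∧ j ≤ r}) ∧
      0 ≤ (ip (h (w r).1) (S.e r)).re ∧ (ip (h (w r).1) (S.e r)).im = 0
  shiftK : ∀ p : Omega, h {p with m := p.m + 1} + Complex.I • h p = h {p with k := p.k + 1}
  shiftL : ∀ p : Omega, h {p with m := p.m + 1} - Complex.I • h p = h {p with l := p.l + 1}
  shiftR : ∀ p : Omega, h {p with n := p.n + 1} + Complex.I • h p = h {p with r := p.r + 1}
  shiftT : ∀ p : Omega, h {p with n := p.n + 1} - Complex.I • h p = h {p with t := p.t + 1}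
  gramFunction : ∃ φ : Omega → ℂ, IsGramFunction h φ

/-! ### The algorithm -/

/-- The Gram–Schmidt orthonormalization of the `h_{m,n}`, listed through `κ`. Linearly dependent
elements give the vector `0`; the other ones form an orthonormal basis of `H₀`. -/
def gs (S : ModelSpace s H) (κ : ℕ ≃ ℕ × ℕ) : ℕ → H :=
  InnerProductSpace.gramSchmidtNormed ℂ (fun i => S.h (κ i).1 (κ i).2)

/-- The index set of the orthonormal basis of `H₀` obtained by Gram–Schmidt. -/
abbrev BasisIndex (S : ModelSpace s H) (κ : ℕ ≃ ℕ × ℕ) : Type := {i : ℕ // S.gs κ i ≠ 0}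

/-- A tuple `(h_{w(0)}, …, h_{w(r-1)})` completed to a family by the `h_{m,n}` (and by `0` at the
indices that are not yet constructed). -/
def tupleFamily (S : ModelSpace s H) (w : Indexation) {r : ℕ} (v : Fin r → H) : Omega → H :=
  S.family w (fun j => if hj : j < r then v ⟨j, hj⟩ else 0)

/-- Step 0: the equations in which only `h_{m,0,0;n,0,0} := h_{m,n}` occur are satisfied. -/
def StepZero (S : ModelSpace s H) (w : Indexation) : Prop :=
  ∀ E : GramEq, E.indices ⊆ OmegaZero → E.Holds (S.tupleFamily w (Fin.elim0 : Fin 0 → H))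

/-- The step that constructs `h_{w(r)}` as the last entry of `v`, the previous entries being given:
for some coefficients `α`, `β_0, …, β_{r-1}` and a number `d` with
`∑ |α_n|² + ∑_{j<r} |β_j|² ≤ d ≤ M_r`, it is
`∑ α_n g_n + ∑_{j<r} β_j e_j + (d - ∑ |α_n|² - ∑_{j<r} |β_j|²)^{1/2} e_r`
(so that `d` is its squared norm), and all equations in which it occurs and in which all other
elements are already constructed are satisfied. -/
def Step (S : ModelSpace s H) (κ : ℕ ≃ ℕ × ℕ) (w : Indexation) (M : ℕ → ℝ) (r : ℕ)
    (v : Fin (r + 1) → H) : Prop :=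
  (∃ (α : S.BasisIndex κ → ℂ) (β : Fin r → ℂ) (d : ℝ),
    Summable (fun i => ‖α i‖ ^ 2) ∧
    ∑' i, ‖α i‖ ^ 2 + ∑ j, ‖β j‖ ^ 2 ≤ d ∧ d ≤ M r ∧
    v (Fin.last r) = ∑' i, α i • S.gs κ i + ∑ j : Fin r, β j • S.e j +
      ((Real.sqrt (d - ∑' i, ‖α i‖ ^ 2 - ∑ j, ‖β j‖ ^ 2) : ℝ) : ℂ) • S.e r) ∧
  ∀ E : GramEq, (w r).1 ∈ E.indices →
    E.indices ⊆ OmegaZero ∪ (fun j => (w j).1) '' {j | j ≤ r} →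
    E.Holds (S.tupleFamily w v)

/-- The set `G_r` of the tuples `(h_{w(0)}, …, h_{w(r-1)})` produced by the first `r` steps. -/
def G (S : ModelSpace s H) (κ : ℕ ≃ ℕ × ℕ) (w : Indexation) (M : ℕ → ℝ) :
    (r : ℕ) → Set (Fin r → H)
  | 0 => Set.univ
  | r + 1 => {v | Fin.init v ∈ G S κ w M r ∧ S.Step κ w M r v}

/-- The sequences `(g_0, g_1, …)` in `H` with finite norm `sup_j ‖g_j‖ / √M_j`, whose first `r`
entries form an element of `G_r` and with `‖g_j‖ ≤ √M_j` for the other ones. -/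
def seqG (S : ModelSpace s H) (κ : ℕ ≃ ℕ × ℕ) (w : Indexation) (M : ℕ → ℝ) (r : ℕ) :
    Set (ℕ → H) :=
  {g | BddAbove (Set.range fun j => 1 / Real.sqrt (M j) * ‖g j‖) ∧
    (fun i : Fin r => g i) ∈ S.G κ w M r ∧ ∀ j, r ≤ j → ‖g j‖ ≤ Real.sqrt (M j)}

/-- The parameter set produced by the algorithm: the intersection over all steps. -/
def paramSet (S : ModelSpace s H) (κ : ℕ ≃ ℕ × ℕ) (w : Indexation) (M : ℕ → ℝ) :
    Set (ℕ → H) :=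
  ⋂ r : ℕ, S.seqG κ w M (r + 1)

end ModelSpace

end

end MomentProblem

open MomentProblem

/-! Splitting z into real and imaginary parts carries solutions of the complex problem to solutions
of the plane problem, by the binomial theorem. Hypothesis `ha` says that the complex moments are
recovered from the plane ones, so the inverse map carries plane solutions back. What remains
concerns the plane.

From the algorithm to a measure: a scalar equation involves finitely many indices, so it is tested
at the step of its last index, and a parameter sequence satisfies all of them (`holds_family`).
Hence the Gram matrix of its family is a function φ of p ∘ p' (`isGramFunction_of_holds`) obeying
the recurrences of the functions y_p (`IsExtension.isShiftSystem`). Every such φ has a representing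
measure (`exists_isExtendedSolution`): the Cayley transforms θ_j = (x_j - i)/(x_j + i) turn part of
the family into a stationary family indexed by ℤ², to which Herglotz' theorem on the torus applies.
The measure is unique because bounded functions already occur among the y_p, and the monomials in
θ_1, θ_2 span a point-separating star algebra (`measure_ext_of_integral_cayley`).

From a measure to the algorithm: for a solution μ the y_p lie in L²(μ). The closed span of the
polynomials is copied isometrically into H₀. The components orthogonal to it are replaced by the
rows of a Cholesky factor of their Gram matrix, read as coordinates along the e_j. Triangularity
with non-negative diagonal is exactly the shape that a step prescribes (`exists_triangular_model`,
`exists_mem_paramSet`). Scalar products are unchanged, so this parameter returns μ. -/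

namespace MomentProblem

noncomputable section

open MeasureTheory Filter Topology

/-! ### Herglotz' theorem on the torus, by Fejér means -/

section Herglotz

open UnitAddTorus

variable {d : Type*} [Fintype d]

/-- The normalized Haar measure of the torus. -/
abbrev torusHaar (d : Type*) [Fintype d] : Measure (UnitAddTorus d) :=
  Measure.pi fun _ => AddCircle.haarAddCircle

theorem integral_mFourier_torusHaar [DecidableEq d] (n : d → ℤ) :
    ∫ x, mFourier n x ∂torusHaar d = if n = 0 then 1 else 0 := by
  have h1 (k : ℤ) : ∫ t : UnitAddCircle, fourier k t ∂AddCircle.haarAddCircle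
      = if k = 0 then 1 else 0 := by
    have := congrFun (fourierCoeff_fourier (T := 1) k) 0
    simp only [fourierCoeff, neg_zero, fourier_zero, one_smul] at this
    rw [this, Pi.single_apply]
    simp [eq_comm]
  simp only [mFourier, ContinuousMap.coe_mk]
  rw [integral_fintype_prod_eq_prod (fun i (t : UnitAddCircle) => fourier (n i) t)]
  simp only [h1]
  split_ifs with h
  · simp [h]
  · obtain ⟨i, hi⟩ := Function.ne_iff.1 h
    exact Finset.prod_eq_zero (Finset.mem_univ i) (if_neg hi)

/-- The cube `{0, …, N-1}^d` of frequencies. -/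
def freqBox (d : Type*) [Fintype d] [DecidableEq d] (N : ℕ) : Finset (d → ℤ) :=
  Fintype.piFinset fun _ => Finset.Ico 0 (N : ℤ)

theorem card_freqBox [DecidableEq d] (N : ℕ) : (freqBox d N).card = N ^ Fintype.card d := by
  simp [freqBox]

/-- In each coordinate the condition cuts out the intersection of an interval of length N with its
translate. The truncated subtraction is right also when the two are disjoint. -/
theorem card_freqBox_shift [DecidableEq d] (N : ℕ) (n : d → ℤ) :
    ((freqBox d N).filter fun a => a - n ∈ freqBox d N).card =
      ∏ i, (N - (n i).natAbs) := by
  have : ((freqBox d N).filter fun a => a - n ∈ freqBox d N) =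
      Fintype.piFinset fun i => Finset.Ico (max 0 (n i)) (min (N : ℤ) (N + n i)) := by
    ext a
    simp only [freqBox, Finset.mem_filter, Fintype.mem_piFinset, Finset.mem_Ico, Pi.sub_apply]
    rw [← forall_and]
    refine forall_congr' fun i => ?_
    omega
  rw [this, Fintype.card_piFinset]
  refine Finset.prod_congr rfl fun i _ => ?_
  rw [Int.card_Ico]
  omega

theorem tendsto_card_freqBox_shift [DecidableEq d] (n : d → ℤ) :
    Tendsto (fun N : ℕ => (((freqBox d N).filter fun a => a - n ∈ freqBox d N).card : ℝ) /
      (freqBox d N).card) atTop (𝓝 1) := by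
  have h1 (k : ℕ) : Tendsto (fun N : ℕ => ((N - k : ℕ) : ℝ) / N) atTop (𝓝 1) := by
    have h2 : Tendsto (fun N : ℕ => 1 - (k : ℝ) / N) atTop (𝓝 (1 - 0)) :=
      tendsto_const_nhds.sub (tendsto_const_div_atTop_nhds_zero_nat _)
    rw [sub_zero] at h2
    refine h2.congr' ?_
    filter_upwards [eventually_ge_atTop (k + 1)] with N hN
    rw [Nat.cast_sub (by omega)]
    have : (N : ℝ) ≠ 0 := by
      have : 0 < N := by omega
      positivity
    field_simp
  have h3 := tendsto_finsetProd (Finset.univ : Finset d) fun i _ => h1 (n i).natAbs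
  rw [Finset.prod_const_one] at h3
  refine h3.congr fun N => ?_
  rw [card_freqBox_shift, card_freqBox, Finset.prod_div_distrib]
  simp

variable {E : Type*} [NormedAddCommGroup E] [InnerProductSpace ℂ E]

theorem ofReal_norm_sq_eq_inner (x : E) : ((‖x‖ ^ 2 : ℝ) : ℂ) = inner ℂ x x := by
  rw [inner_self_eq_norm_sq_to_K]
  simp

/-- The Fejér-type density `N⁻ᵈ ‖∑_a e_{-a}(x) v_a‖²`. -/
def fejerDensity [DecidableEq d] (v : (d → ℤ) → E) (N : ℕ) (x : UnitAddTorus d) : ℝ :=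
  ‖∑ a ∈ freqBox d N, mFourier (-a) x • v a‖ ^ 2 / (freqBox d N).card

theorem continuous_fejerDensity [DecidableEq d] (v : (d → ℤ) → E) (N : ℕ) :
    Continuous (fejerDensity v N) := by
  unfold fejerDensity
  fun_prop

/-- Expanding the square, orthogonality of characters keeps only the pairs with a - b = n.
Stationarity gives each of them the value c n, and there is one for every a in the box with a - n in
the box. -/
theorem integral_mFourier_mul_fejerDensity [DecidableEq d] {v : (d → ℤ) → E} {c : (d → ℤ) → ℂ}
    (hc : ∀ a b, inner ℂ (v b) (v a) = c (a - b)) (N : ℕ) (n : d → ℤ) :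
    ∫ x, mFourier n x * (fejerDensity v N x : ℂ) ∂torusHaar d =
      (((freqBox d N).filter fun a => a - n ∈ freqBox d N).card : ℝ) /
        ((freqBox d N).card : ℝ) * c n := by
  have h1 (x : UnitAddTorus d) : mFourier n x * (fejerDensity v N x : ℂ) =
      ∑ b ∈ freqBox d N, ∑ a ∈ freqBox d N,
        mFourier (n + b - a) x * (c (a - b) / (freqBox d N).card) := by
    simp only [fejerDensity]
    rw [Complex.ofReal_div, ofReal_norm_sq_eq_inner, Complex.ofReal_natCast]
    simp only [sum_inner, inner_sum, inner_smul_left, inner_smul_right, hc, Finset.sum_div,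
      Finset.mul_sum]
    rw [Finset.sum_comm]
    refine Finset.sum_congr rfl fun b _ => Finset.sum_congr rfl fun a _ => ?_
    rw [sub_eq_add_neg (n + b), mFourier_add, mFourier_add, ← mFourier_neg, neg_neg]
    ring
  have hi (m : d → ℤ) (k : ℂ) : Integrable (fun x => mFourier m x * k) (torusHaar d) :=
    ((mFourier m).continuous.mul continuous_const).integrable_of_hasCompactSupport
      (HasCompactSupport.of_compactSpace _)
  simp only [h1]
  rw [integral_finsetSum _ fun b _ => integrable_finsetSum _ fun a _ => hi _ _]
  have h2 (b : d → ℤ) : ∫ x, ∑ a ∈ freqBox d N,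
      mFourier (n + b - a) x * (c (a - b) / (freqBox d N).card) ∂torusHaar d =
      ∑ a ∈ freqBox d N, if n + b - a = 0 then c (a - b) / (freqBox d N).card else 0 := by
    rw [integral_finsetSum _ fun a _ => hi _ _]
    refine Finset.sum_congr rfl fun a _ => ?_
    rw [integral_mul_const, integral_mFourier_torusHaar]
    split_ifs <;> simp
  simp only [h2]
  rw [Finset.sum_comm]
  have h3 (a : d → ℤ) : (∑ b ∈ freqBox d N,
      if n + b - a = 0 then c (a - b) / (freqBox d N).card else 0) =
      if a - n ∈ freqBox d N then c n / (freqBox d N).card else 0 := by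
    have : ∀ b, n + b - a = 0 ↔ b = a - n := fun b => by
      rw [sub_eq_zero, ← eq_sub_iff_add_eq']
    simp only [this, Finset.sum_ite_eq']
    congr 2
    abel_nf
  simp only [h3]
  rw [← Finset.sum_filter, Finset.sum_const, nsmul_eq_mul]
  push_cast
  ring

/-- **Herglotz' theorem** on the `d`-dimensional torus: the scalar products of a stationary family
of vectors indexed by `ℤᵈ` are the Fourier coefficients of a finite measure. -/
theorem exists_measure_integral_mFourier_eq {v : (d → ℤ) → E} {c : (d → ℤ) → ℂ}
    (hc : ∀ a b, inner ℂ (v b) (v a) = c (a - b)) :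
    ∃ ν : Measure (UnitAddTorus d), IsFiniteMeasure ν ∧ ∀ n, ∫ x, mFourier n x ∂ν = c n := by
  classical
  have hint (N : ℕ) : Integrable (fejerDensity v N) (torusHaar d) :=
    (continuous_fejerDensity v N).integrable_of_hasCompactSupport
      (HasCompactSupport.of_compactSpace _)
  have hnn (N : ℕ) (x) : 0 ≤ fejerDensity v N x := by unfold fejerDensity; positivity
  let P (N : ℕ) : FiniteMeasure (UnitAddTorus d) :=
    ⟨(torusHaar d).withDensity fun x => ENNReal.ofReal (fejerDensity v N x),
      isFiniteMeasure_withDensity_ofReal (hint N).2⟩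
  have hP (N : ℕ) (n : d → ℤ) : ∫ x, mFourier n x ∂(P N : Measure (UnitAddTorus d)) =
      (((freqBox d N).filter fun a => a - n ∈ freqBox d N).card : ℝ) /
        ((freqBox d N).card : ℝ) * c n := by
    rw [← integral_mFourier_mul_fejerDensity hc]
    simp only [P, FiniteMeasure.toMeasure_mk]
    rw [integral_withDensity_eq_integral_toReal_smul
      (by have := continuous_fejerDensity v N; fun_prop) (by simp)]
    refine integral_congr_ae (.of_forall fun x => ?_)
    simp only [ENNReal.toReal_ofReal (hnn N x), Complex.real_smul]
    ring
  have hlim (n : d → ℤ) :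
      Tendsto (fun N => ∫ x, mFourier n x ∂(P N : Measure (UnitAddTorus d))) atTop (𝓝 (c n)) := by
    have h1 : Tendsto (fun N : ℕ => (((((freqBox d N).filter fun a => a - n ∈ freqBox d N).card :
        ℝ) / ((freqBox d N).card : ℝ) : ℝ) : ℂ) * c n) atTop (𝓝 (((1 : ℝ) : ℂ) * c n)) :=
      ((Complex.continuous_ofReal.tendsto _).comp (tendsto_card_freqBox_shift n)).mul_const _
    rw [Complex.ofReal_one, one_mul] at h1
    refine h1.congr fun N => ?_
    rw [hP]
    push_cast
    rfl
  -- The total mass is the Fourier coefficient at 0, and the Fejér factor is at most 1.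
  have hmass (N : ℕ) : (P N).mass ≤ ‖c 0‖₊ := by
    have h1 := hP N 0
    simp only [mFourier_zero, ContinuousMap.one_apply, integral_const, Complex.real_smul,
      mul_one] at h1
    have h2 : ((P N).mass : ℝ) = ‖(((P N : Measure (UnitAddTorus d)).real Set.univ : ℝ) : ℂ)‖ := by
      rw [Complex.norm_real, Real.norm_of_nonneg measureReal_nonneg]
      rfl
    rw [← NNReal.coe_le_coe, h2, h1, norm_mul, coe_nnnorm]
    refine mul_le_of_le_one_left (norm_nonneg _) ?_
    rw [← Complex.ofReal_div, Complex.norm_real, Real.norm_of_nonneg (by positivity)]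
    refine div_le_one_of_le₀ ?_ (by positivity)
    exact_mod_cast Finset.card_filter_le _ _
  -- Measures of bounded mass on the compact torus form a compact set, so a limit exists along an
  -- ultrafilter finer than `atTop`. No convergent subsequence has to be chosen.
  obtain ⟨ν, -, hν⟩ := (isCompact_setOfPred_finiteMeasure_le_of_compactSpace (UnitAddTorus d)
    ‖c 0‖₊).ultrafilter_le_nhds ((hyperfilter ℕ : Ultrafilter ℕ).map P) (by
      rw [le_principal_iff]
      exact Filter.mem_map.2 (Filter.univ_mem' hmass))
  refine ⟨ν, inferInstance, fun n => ?_⟩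
  have hν' : Tendsto P (hyperfilter ℕ : Filter ℕ) (𝓝 ν) := hν
  rw [FiniteMeasure.tendsto_iff_forall_integral_rclike_tendsto ℂ] at hν'
  refine tendsto_nhds_unique (hν' (BoundedContinuousFunction.mkOfCompact (mFourier n))) ?_
  exact (hlim n).mono_left Nat.hyperfilter_le_atTop

end Herglotz

/-! ### Recurrences of the functions y_p and of their moments -/

section Shift

/-- The recurrences satisfied by the functions `Omega.fn`, and hence by all extended moments. -/
structure IsShiftSystem (φ : Omega → ℂ) : Prop where
  shiftK : ∀ m k l n r t, φ ⟨m + 1, k, l, n, r, t⟩ + Complex.I * φ ⟨m, k, l, n, r, t⟩ =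
    φ ⟨m, k + 1, l, n, r, t⟩
  shiftL : ∀ m k l n r t, φ ⟨m + 1, k, l, n, r, t⟩ - Complex.I * φ ⟨m, k, l, n, r, t⟩ =
    φ ⟨m, k, l + 1, n, r, t⟩
  shiftR : ∀ m k l n r t, φ ⟨m, k, l, n + 1, r, t⟩ + Complex.I * φ ⟨m, k, l, n, r, t⟩ =
    φ ⟨m, k, l, n, r + 1, t⟩
  shiftT : ∀ m k l n r t, φ ⟨m, k, l, n + 1, r, t⟩ - Complex.I * φ ⟨m, k, l, n, r, t⟩ =
    φ ⟨m, k, l, n, r, t + 1⟩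

/-- This reflects 2i = (x₁ + i) - (x₁ - i). It expresses a value through two values of total degree
k + l higher by one, which is what inductions over negative degrees use. -/
theorem IsShiftSystem.two_I_mul_kl {φ : Omega → ℂ} (h : IsShiftSystem φ) (m k l n r t) :
    2 * Complex.I * φ ⟨m, k, l, n, r, t⟩ =
      φ ⟨m, k + 1, l, n, r, t⟩ - φ ⟨m, k, l + 1, n, r, t⟩ := by
  rw [← h.shiftK, ← h.shiftL]; ring

theorem IsShiftSystem.two_I_mul_rt {φ : Omega → ℂ} (h : IsShiftSystem φ) (m k l n r t) :
    2 * Complex.I * φ ⟨m, k, l, n, r, t⟩ =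
      φ ⟨m, k, l, n, r + 1, t⟩ - φ ⟨m, k, l, n, r, t + 1⟩ := by
  rw [← h.shiftR, ← h.shiftT]; ring

/-- The identity 2i = (x₁ + i) - (x₁ - i), squared. It mirrors |1 - θ|² = 4/(1 + x²), the weight
used below on the torus. -/
theorem IsShiftSystem.four_mul_kl {φ : Omega → ℂ} (h : IsShiftSystem φ) (m k l n r t) :
    4 * φ ⟨m, k, l, n, r, t⟩ = 2 * φ ⟨m, k + 1, l + 1, n, r, t⟩ - φ ⟨m, k + 2, l, n, r, t⟩ -
      φ ⟨m, k, l + 2, n, r, t⟩ := by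
  have h1 := h.two_I_mul_kl m k l n r t
  have h2 := h.two_I_mul_kl m (k + 1) l n r t
  have h3 := h.two_I_mul_kl m k (l + 1) n r t
  rw [add_assoc, one_add_one_eq_two] at h2 h3
  linear_combination (-2 * Complex.I) * h1 - h2 + h3 + 4 * φ ⟨m, k, l, n, r, t⟩ * Complex.I_sq

theorem IsShiftSystem.four_mul_rt {φ : Omega → ℂ} (h : IsShiftSystem φ) (m k l n r t) :
    4 * φ ⟨m, k, l, n, r, t⟩ = 2 * φ ⟨m, k, l, n, r + 1, t + 1⟩ - φ ⟨m, k, l, n, r + 2, t⟩ -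
      φ ⟨m, k, l, n, r, t + 2⟩ := by
  have h1 := h.two_I_mul_rt m k l n r t
  have h2 := h.two_I_mul_rt m k l n (r + 1) t
  have h3 := h.two_I_mul_rt m k l n r (t + 1)
  rw [add_assoc, one_add_one_eq_two] at h2 h3
  linear_combination (-2 * Complex.I) * h1 - h2 + h3 + 4 * φ ⟨m, k, l, n, r, t⟩ * Complex.I_sq

/-- Multiplication by `((x₁² + 1)(x₂² + 1))ᴺ` on the level of indices. -/
theorem IsShiftSystem.translate {φ : Omega → ℂ} (h : IsShiftSystem φ) (N : ℤ) :
    IsShiftSystem fun p => φ ⟨p.m, N + p.k, N + p.l, p.n, N + p.r, N + p.t⟩ where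
  shiftK m k l n r t := by simpa only [add_assoc] using h.shiftK m (N + k) (N + l) n (N + r) (N + t)
  shiftL m k l n r t := by simpa only [add_assoc] using h.shiftL m (N + k) (N + l) n (N + r) (N + t)
  shiftR m k l n r t := by simpa only [add_assoc] using h.shiftR m (N + k) (N + l) n (N + r) (N + t)
  shiftT m k l n r t := by simpa only [add_assoc] using h.shiftT m (N + k) (N + l) n (N + r) (N + t)

theorem ofReal_add_I_ne_zero (x : ℝ) : (x : ℂ) + Complex.I ≠ 0 := fun h => by
  simpa using congrArg Complex.im h

theorem ofReal_sub_I_ne_zero (x : ℝ) : (x : ℂ) - Complex.I ≠ 0 := fun h => by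
  simpa using congrArg Complex.im h

theorem isShiftSystem_fn (x : ℝ × ℝ) : IsShiftSystem fun p => p.fn x where
  shiftK m k l n r t := by
    simp only [Omega.fn, zpow_add_one₀ (ofReal_add_I_ne_zero _)]; ring
  shiftL m k l n r t := by
    simp only [Omega.fn, zpow_add_one₀ (ofReal_sub_I_ne_zero _)]; ring
  shiftR m k l n r t := by
    simp only [Omega.fn, zpow_add_one₀ (ofReal_add_I_ne_zero _)]; ring
  shiftT m k l n r t := by
    simp only [Omega.fn, zpow_add_one₀ (ofReal_sub_I_ne_zero _)]; ring

theorem conj_ofReal_add_I (x : ℝ) : starRingEnd ℂ ((x : ℂ) + Complex.I) = x - Complex.I := by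
  simp [sub_eq_add_neg]

theorem conj_ofReal_sub_I (x : ℝ) : starRingEnd ℂ ((x : ℂ) - Complex.I) = x + Complex.I := by
  simp

theorem fn_conjAdd (p q : Omega) (x : ℝ × ℝ) :
    (p.conjAdd q).fn x = p.fn x * starRingEnd ℂ (q.fn x) := by
  simp only [Omega.fn, Omega.conjAdd, map_mul, map_pow, map_zpow₀, conj_ofReal_add_I,
    conj_ofReal_sub_I, Complex.conj_ofReal, zpow_add₀ (ofReal_add_I_ne_zero _),
    zpow_add₀ (ofReal_sub_I_ne_zero _), pow_add]
  ring

theorem continuous_fn (p : Omega) : Continuous p.fn := by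
  unfold Omega.fn
  refine ((Continuous.mul (by fun_prop) (.zpow₀ (by fun_prop) _ fun x => ?_)).mul
    (.zpow₀ (by fun_prop) _ fun x => ?_)).mul ((Continuous.mul (by fun_prop)
    (.zpow₀ (by fun_prop) _ fun x => ?_)).mul (.zpow₀ (by fun_prop) _ fun x => ?_))
  all_goals first
    | exact .inl (ofReal_add_I_ne_zero _)
    | exact .inl (ofReal_sub_I_ne_zero _)

theorem norm_ofReal_add_I (x : ℝ) : ‖(x : ℂ) + Complex.I‖ = Real.sqrt (1 + x ^ 2) := by
  simpa [add_comm] using Complex.norm_add_mul_I x 1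

theorem norm_ofReal_sub_I (x : ℝ) : ‖(x : ℂ) - Complex.I‖ = Real.sqrt (1 + x ^ 2) := by
  rw [← conj_ofReal_add_I, RCLike.norm_conj, norm_ofReal_add_I]

theorem norm_fn (p : Omega) (x : ℝ × ℝ) :
    ‖p.fn x‖ = |x.1| ^ p.m * Real.sqrt (1 + x.1 ^ 2) ^ (p.k + p.l) *
      (|x.2| ^ p.n * Real.sqrt (1 + x.2 ^ 2) ^ (p.r + p.t)) := by
  have h (y : ℝ) : Real.sqrt (1 + y ^ 2) ≠ 0 := by positivity
  simp only [Omega.fn, norm_mul, norm_pow, norm_zpow, norm_ofReal_add_I, norm_ofReal_sub_I,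
    Complex.norm_real, Real.norm_eq_abs, zpow_add₀ (h _)]
  ring

theorem norm_fn_le_one (k l r t : ℤ) (h1 : k + l ≤ 0) (h2 : r + t ≤ 0) (x : ℝ × ℝ) :
    ‖Omega.fn ⟨0, k, l, 0, r, t⟩ x‖ ≤ 1 := by
  have h (y : ℝ) : 1 ≤ Real.sqrt (1 + y ^ 2) :=
    Real.one_le_sqrt.2 (by nlinarith [sq_nonneg y])
  rw [norm_fn]
  simp only [pow_zero, one_mul]
  exact mul_le_one₀ (zpow_le_one_of_nonpos₀ (h _) h1) (by positivity)
    (zpow_le_one_of_nonpos₀ (h _) h2)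

theorem integrable_fn_of_nonpos {μ : Measure (ℝ × ℝ)} [IsFiniteMeasure μ] (k l r t : ℤ)
    (h1 : k + l ≤ 0) (h2 : r + t ≤ 0) : Integrable (Omega.fn ⟨0, k, l, 0, r, t⟩) μ :=
  .of_bound (continuous_fn _).aestronglyMeasurable 1
    (.of_forall fun x => norm_fn_le_one k l r t h1 h2 x)

/-- The integrals of all bounded functions `fn` with `m = n = 0` are determined by those of the
products of Cayley transforms. -/
theorem IsShiftSystem.integral_fn_eq_of_nonpos {φ : Omega → ℂ} (h : IsShiftSystem φ)
    {μ : Measure (ℝ × ℝ)} [IsFiniteMeasure μ]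
    (hμ : ∀ j k : ℤ, ∫ x, Omega.fn ⟨0, -j, j, 0, -k, k⟩ x ∂μ = φ ⟨0, -j, j, 0, -k, k⟩)
    (k l r t : ℤ) (h1 : k + l ≤ 0) (h2 : r + t ≤ 0) :
    ∫ x, Omega.fn ⟨0, k, l, 0, r, t⟩ x ∂μ = φ ⟨0, k, l, 0, r, t⟩ := by
  -- Induction on the deficit -(k + l), keeping r + t = 0; the second pair is then lowered in the
  -- same way. Degree 0 is the hypothesis on Cayley monomials.
  have hkl (s : ℕ) : ∀ k l r t : ℤ, k + l = -s → r + t = 0 →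
      ∫ x, Omega.fn ⟨0, k, l, 0, r, t⟩ x ∂μ = φ ⟨0, k, l, 0, r, t⟩ := by
    induction s with
    | zero =>
      intro k l r t h1 h2
      obtain rfl : k = -l := by simp at h1; omega
      obtain rfl : r = -t := by omega
      exact hμ l t
    | succ s ih =>
      intro k l r t h1 h2
      push_cast at h1
      refine mul_left_cancel₀ (mul_ne_zero two_ne_zero Complex.I_ne_zero) ?_
      rw [h.two_I_mul_kl, ← integral_const_mul, ← ih (k + 1) l r t (by omega) h2,
        ← ih k (l + 1) r t (by omega) h2, ← integral_sub
          (integrable_fn_of_nonpos _ _ _ _ (by omega) (by omega))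
          (integrable_fn_of_nonpos _ _ _ _ (by omega) (by omega))]
      simp only [(isShiftSystem_fn _).two_I_mul_kl]
  have hrt (s : ℕ) : ∀ k l r t : ℤ, k + l ≤ 0 → r + t = -s →
      ∫ x, Omega.fn ⟨0, k, l, 0, r, t⟩ x ∂μ = φ ⟨0, k, l, 0, r, t⟩ := by
    induction s with
    | zero => exact fun k l r t h1 h2 => hkl (-(k + l)).toNat k l r t (by omega) (by simpa using h2)
    | succ s ih =>
      intro k l r t h1 h2
      push_cast at h2
      refine mul_left_cancel₀ (mul_ne_zero two_ne_zero Complex.I_ne_zero) ?_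
      rw [h.two_I_mul_rt, ← integral_const_mul, ← ih k l (r + 1) t h1 (by omega),
        ← ih k l r (t + 1) h1 (by omega), ← integral_sub
          (integrable_fn_of_nonpos _ _ _ _ (by omega) (by omega))
          (integrable_fn_of_nonpos _ _ _ _ (by omega) (by omega))]
      simp only [(isShiftSystem_fn _).two_I_mul_rt]
  exact hrt (-(r + t)).toNat k l r t h1 (by omega)

end Shift

/-! ### Uniqueness through the Cayley transforms -/

section Uniqueness

open BoundedContinuousFunction

/-- The product of powers of the Cayley transforms of the coordinates, as a bounded function. -/
def cayleyMonomial (a : ℤ × ℤ) : (ℝ × ℝ) →ᵇ ℂ :=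
  .ofNormedAddCommGroup (Omega.fn ⟨0, -a.1, a.1, 0, -a.2, a.2⟩) (continuous_fn _) 1
    (norm_fn_le_one _ _ _ _ (by omega) (by omega))

theorem cayleyMonomial_apply (a : ℤ × ℤ) (x : ℝ × ℝ) :
    cayleyMonomial a x = Omega.fn ⟨0, -a.1, a.1, 0, -a.2, a.2⟩ x := rfl

theorem cayleyMonomial_zero : cayleyMonomial 0 = 1 := by
  ext x
  simp [cayleyMonomial_apply, Omega.fn]

theorem cayleyMonomial_add (a b : ℤ × ℤ) :
    cayleyMonomial (a + b) = cayleyMonomial a * cayleyMonomial b := by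
  ext x
  simp only [cayleyMonomial_apply, Omega.fn, BoundedContinuousFunction.coe_mul, Pi.mul_apply,
    Prod.fst_add, Prod.snd_add, neg_add, zpow_add₀ (ofReal_add_I_ne_zero _),
    zpow_add₀ (ofReal_sub_I_ne_zero _)]
  ring

theorem star_cayleyMonomial (a : ℤ × ℤ) : star (cayleyMonomial a) = cayleyMonomial (-a) := by
  ext x
  simp only [cayleyMonomial_apply, Omega.fn, BoundedContinuousFunction.star_apply, RCLike.star_def,
    map_mul, map_pow, map_zpow₀, conj_ofReal_add_I, conj_ofReal_sub_I, Complex.conj_ofReal,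
    Prod.fst_neg, Prod.snd_neg, neg_neg]
  ring

/-- The star algebra of bounded functions generated by the Cayley transforms of the coordinates. -/
def cayleySubalgebra : StarSubalgebra ℂ ((ℝ × ℝ) →ᵇ ℂ) where
  toSubalgebra := Algebra.adjoin ℂ (Set.range cayleyMonomial)
  star_mem' := by
    change Algebra.adjoin ℂ (Set.range cayleyMonomial) ≤
      star (Algebra.adjoin ℂ (Set.range cayleyMonomial))
    refine Algebra.adjoin_le ?_
    rintro - ⟨a, rfl⟩
    exact Algebra.subset_adjoin ⟨-a, (star_cayleyMonomial a).symm⟩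

/-- The monomials are closed under multiplication, so the algebra is only a linear span, and
integrals over it are determined by linearity. -/
theorem cayleySubalgebra_toSubmodule :
    Subalgebra.toSubmodule cayleySubalgebra.toSubalgebra =
      Submodule.span ℂ (Set.range cayleyMonomial) := by
  refine Algebra.adjoin_eq_span_of_subset ℂ ?_
  refine Set.Subset.trans ?_ Submodule.subset_span
  intro x hx
  refine Submonoid.closure_induction (fun _ => id) ⟨0, cayleyMonomial_zero⟩ ?_ hx
  rintro _ _ _ _ ⟨a, rfl⟩ ⟨b, rfl⟩
  exact ⟨a + b, cayleyMonomial_add a b⟩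

theorem ofReal_eq_of_cayley_eq {x y : ℝ}
    (h : ((x : ℂ) - Complex.I) / (x + Complex.I) = ((y : ℂ) - Complex.I) / (y + Complex.I)) :
    x = y := by
  rw [div_eq_div_iff (ofReal_add_I_ne_zero _) (ofReal_add_I_ne_zero _)] at h
  have h2 : 2 * Complex.I * ((x : ℂ) - y) = 0 := by linear_combination h
  simpa [sub_eq_zero] using h2

theorem cayleySubalgebra_separatesPoints :
    (cayleySubalgebra.map (toContinuousMapStarₐ ℂ)).SeparatesPoints := by
  intro x y hxy
  have hmem (a : ℤ × ℤ) : (toContinuousMapStarₐ ℂ (cayleyMonomial a) : ℝ × ℝ → ℂ) ∈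
      (fun f : C(ℝ × ℝ, ℂ) => (f : ℝ × ℝ → ℂ)) ''
        ((cayleySubalgebra.map (toContinuousMapStarₐ ℂ) : StarSubalgebra ℂ C(ℝ × ℝ, ℂ)) :
          Set C(ℝ × ℝ, ℂ)) :=
    ⟨_, ⟨cayleyMonomial a, Algebra.subset_adjoin ⟨a, rfl⟩, rfl⟩, rfl⟩
  by_contra! hne
  have h1 := hne _ (hmem (1, 0))
  have h2 := hne _ (hmem (0, 1))
  change cayleyMonomial _ x = cayleyMonomial _ y at h1 h2
  simp only [cayleyMonomial_apply, Omega.fn, pow_zero, neg_zero, zpow_zero, one_mul, mul_one,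
    zpow_neg, zpow_one, inv_mul_eq_div] at h1 h2
  exact hxy (Prod.ext (ofReal_eq_of_cayley_eq h1) (ofReal_eq_of_cayley_eq h2))

/-- A finite measure on the plane is determined by its integrals of the products of powers of the
Cayley transforms of the coordinates. -/
theorem measure_ext_of_integral_cayley {μ μ' : Measure (ℝ × ℝ)} [IsFiniteMeasure μ]
    [IsFiniteMeasure μ'] (h : ∀ j k : ℤ, ∫ x, Omega.fn ⟨0, -j, j, 0, -k, k⟩ x ∂μ =
      ∫ x, Omega.fn ⟨0, -j, j, 0, -k, k⟩ x ∂μ') : μ = μ' := by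
  refine ext_of_forall_mem_subalgebra_integral_eq_of_polish cayleySubalgebra_separatesPoints
    fun g hg => ?_
  have hg' : g ∈ Submodule.span ℂ (Set.range cayleyMonomial) := by
    rw [← cayleySubalgebra_toSubmodule]; exact hg
  clear hg
  induction hg' using Submodule.span_induction with
  | mem _ hx => obtain ⟨a, rfl⟩ := hx; exact h a.1 a.2
  | zero => simp
  | add f g _ _ hf hg =>
    simp only [BoundedContinuousFunction.coe_add, Pi.add_apply]
    rw [integral_add (f.integrable _) (g.integrable _),
      integral_add (f.integrable _) (g.integrable _), hf, hg]
  | smul c f _ hf =>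
    simp only [BoundedContinuousFunction.coe_smul]
    rw [integral_smul, integral_smul, hf]

end Uniqueness

/-! ### Existence: from the torus back to the plane -/

section Existence

open UnitAddTorus

theorem fourier_eq_zpow (n : ℤ) (t : UnitAddCircle) : fourier n t = (fourier 1 t : ℂ) ^ n := by
  rw [fourier_apply, fourier_one, AddCircle.toCircle_zsmul, Circle.coe_zpow]

theorem norm_fourier_apply (n : ℤ) (t : UnitAddCircle) : ‖(fourier n t : ℂ)‖ = 1 := by
  rw [fourier_apply, Circle.norm_coe]

/-- The inverse Cayley transform, from the circle to the line. -/
def cayleyInv (t : UnitAddCircle) : ℝ :=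
  (Complex.I * (1 + fourier 1 t) / (1 - fourier 1 t)).re

theorem measurable_cayleyInv : Measurable cayleyInv := by
  unfold cayleyInv
  have : Measurable fun t : UnitAddCircle => (fourier 1 t : ℂ) := (fourier 1).continuous.measurable
  fun_prop

/-- On the circle conjugation is inversion, and i(1 + z)/(1 - z) is invariant under it. At z = 1
division by zero gives the real value 0. -/
theorem ofReal_cayleyInv (t : UnitAddCircle) :
    (cayleyInv t : ℂ) = Complex.I * (1 + fourier 1 t) / (1 - fourier 1 t) := by
  refine Complex.conj_eq_iff_re.1 ?_
  have h0 : (fourier 1 t : ℂ) ≠ 0 := norm_ne_zero_iff.1 (by rw [norm_fourier_apply]; simp)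
  by_cases h1 : (fourier 1 t : ℂ) = 1
  · simp [h1]
  · have h2 : 1 - (fourier 1 t : ℂ) ≠ 0 := sub_ne_zero.2 (Ne.symm h1)
    have h3 : (fourier 1 t : ℂ) - 1 ≠ 0 := sub_ne_zero.2 h1
    simp only [map_div₀, map_mul, map_add, map_sub, map_one, Complex.conj_I,
      ← Complex.inv_eq_conj (norm_fourier_apply 1 t)]
    field_simp
    ring

/-- For z ≠ 1 the Cayley quotient is z and |1 - z|² = 2 - z - z⁻¹. At z = 1, the point at infinity
of the line, both sides vanish, so the default value of `cayleyInv` there is harmless. -/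
theorem norm_sub_sq_mul_cayley (t : UnitAddCircle) (j : ℤ) :
    ((‖1 - (fourier 1 t : ℂ)‖ ^ 2 : ℝ) : ℂ) *
      (((cayleyInv t : ℂ) + Complex.I) ^ (-j) * ((cayleyInv t : ℂ) - Complex.I) ^ j) =
    2 * fourier j t - fourier (j - 1) t - fourier (j + 1) t := by
  have h0 : (fourier 1 t : ℂ) ≠ 0 := norm_ne_zero_iff.1 (by rw [norm_fourier_apply]; simp)
  rw [fourier_eq_zpow j, fourier_eq_zpow (j - 1), fourier_eq_zpow (j + 1)]
  by_cases h1 : (fourier 1 t : ℂ) = 1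
  · simp only [h1]; norm_num
  · have h2 : 1 - (fourier 1 t : ℂ) ≠ 0 := sub_ne_zero.2 (Ne.symm h1)
    have h3 : (cayleyInv t : ℂ) - Complex.I = fourier 1 t * ((cayleyInv t : ℂ) + Complex.I) := by
      rw [ofReal_cayleyInv]
      field_simp
      ring
    rw [h3, mul_zpow, mul_left_comm (_ ^ (-j)), ← zpow_add₀ (ofReal_add_I_ne_zero _),
      neg_add_cancel, zpow_zero, mul_one, zpow_add_one₀ h0, zpow_sub_one₀ h0]
    have h4 : ((‖1 - (fourier 1 t : ℂ)‖ ^ 2 : ℝ) : ℂ) =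
        (1 - fourier 1 t) * (1 - (fourier 1 t : ℂ)⁻¹) := by
      rw [Complex.inv_eq_conj (norm_fourier_apply 1 t), ← map_one (starRingEnd ℂ), ← map_sub,
        map_one, Complex.mul_conj, Complex.normSq_eq_norm_sq]
    rw [h4]
    field_simp
    ring

theorem mFourier_fin_two (a b : ℤ) (x : UnitAddTorus (Fin 2)) :
    mFourier ![a, b] x = fourier a (x 0) * fourier b (x 1) := by
  simp [mFourier, Fin.prod_univ_two]

theorem integral_mFourier_combination {ν : Measure (UnitAddTorus (Fin 2))} [IsFiniteMeasure ν]
    (j k : ℤ) :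
    ∫ x : UnitAddTorus (Fin 2),
      (2 * fourier j (x 0) - fourier (j - 1) (x 0) - fourier (j + 1) (x 0) : ℂ) *
      (2 * fourier k (x 1) - fourier (k - 1) (x 1) - fourier (k + 1) (x 1)) ∂ν =
    2 * (2 * ∫ x, mFourier ![j, k] x ∂ν - ∫ x, mFourier ![j, k - 1] x ∂ν -
        ∫ x, mFourier ![j, k + 1] x ∂ν) -
      (2 * ∫ x, mFourier ![j - 1, k] x ∂ν - ∫ x, mFourier ![j - 1, k - 1] x ∂ν -
        ∫ x, mFourier ![j - 1, k + 1] x ∂ν) -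
      (2 * ∫ x, mFourier ![j + 1, k] x ∂ν - ∫ x, mFourier ![j + 1, k - 1] x ∂ν -
        ∫ x, mFourier ![j + 1, k + 1] x ∂ν) := by
  have hi (n : Fin 2 → ℤ) : Integrable (fun x => mFourier n x) ν :=
    (mFourier n).continuous.integrable_of_hasCompactSupport (HasCompactSupport.of_compactSpace _)
  have hcomb {f g e : UnitAddTorus (Fin 2) → ℂ} (hf : Integrable f ν) (hg : Integrable g ν)
      (he : Integrable e ν) : Integrable (fun x => 2 * f x - g x - e x) ν ∧
      ∫ x, 2 * f x - g x - e x ∂ν = 2 * ∫ x, f x ∂ν - ∫ x, g x ∂ν - ∫ x, e x ∂ν := by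
    have h1 : Integrable (fun x => 2 * f x) ν := hf.const_mul 2
    have h2 : Integrable (fun x => 2 * f x - g x) ν := h1.sub hg
    exact ⟨h2.sub he, by rw [integral_sub h2 he, integral_sub h1 hg, integral_const_mul]⟩
  have hrow (a : ℤ) := hcomb (hi ![a, k]) (hi ![a, k - 1]) (hi ![a, k + 1])
  rw [← (hrow j).2, ← (hrow (j - 1)).2, ← (hrow (j + 1)).2,
    ← (hcomb (hrow j).1 (hrow (j - 1)).1 (hrow (j + 1)).1).2]
  refine integral_congr_ae (.of_forall fun x => ?_)
  simp only [mFourier_fin_two]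
  ring

variable {E : Type*} [NormedAddCommGroup E] [InnerProductSpace ℂ E]

/-- The measure found here plays the role of ((1 + x₁²)(1 + x₂²))ᴺ dμ for the solution μ still to be
constructed. Herglotz' theorem is used at level N + 1; the extra factor is divided out by a weight
that also removes any mass at infinity. -/
theorem exists_measure_integral_cayley_eq {φ : Omega → ℂ} (hs : IsShiftSystem φ) {h : Omega → E}
    (hφ : IsGramFunction h φ) (N : ℤ) :
    ∃ μ : Measure (ℝ × ℝ), IsFiniteMeasure μ ∧ ∀ j k : ℤ,
      ∫ x, Omega.fn ⟨0, -j, j, 0, -k, k⟩ x ∂μ = φ ⟨0, N - j, N + j, 0, N - k, N + k⟩ := by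
  -- The vector at a stands for the function ∏ (x_j + i)^(N+1) θ_j^(a_j), so scalar products depend
  -- on a - b only.
  obtain ⟨ν, hν, hνc⟩ := exists_measure_integral_mFourier_eq
    (v := fun a : Fin 2 → ℤ => h ⟨0, N + 1 - a 0, a 0, 0, N + 1 - a 1, a 1⟩)
    (c := fun n => φ ⟨0, N + 1 - n 0, N + 1 + n 0, 0, N + 1 - n 1, N + 1 + n 1⟩) (by
      intro a b
      refine (hφ _ _).trans (congrArg φ ?_)
      simp only [Omega.conjAdd, Pi.sub_apply, Omega.mk.injEq]
      refine ⟨trivial, ?_, ?_, trivial, ?_, ?_⟩ <;> ring)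
  -- Under the Cayley transform this is 1/((1 + x₁²)(1 + x₂²)); the 16 is 4 for each coordinate.
  let W : UnitAddTorus (Fin 2) → ℝ := fun x =>
    ‖1 - (fourier 1 (x 0) : ℂ)‖ ^ 2 * ‖1 - (fourier 1 (x 1) : ℂ)‖ ^ 2 / 16
  have hWc : Continuous W := by fun_prop
  have hW0 (x) : 0 ≤ W x := by positivity
  have hWi : Integrable W ν :=
    hWc.integrable_of_hasCompactSupport (HasCompactSupport.of_compactSpace _)
  let Q : UnitAddTorus (Fin 2) → ℝ × ℝ := fun x => (cayleyInv (x 0), cayleyInv (x 1))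
  have hQ : Measurable Q := (measurable_cayleyInv.comp (measurable_pi_apply 0)).prodMk
    (measurable_cayleyInv.comp (measurable_pi_apply 1))
  have hfin : IsFiniteMeasure (ν.withDensity fun x => ENNReal.ofReal (W x)) :=
    isFiniteMeasure_withDensity_ofReal hWi.2
  refine ⟨(ν.withDensity fun x => ENNReal.ofReal (W x)).map Q, inferInstance, fun j k => ?_⟩
  rw [integral_map hQ.aemeasurable (continuous_fn _).aestronglyMeasurable,
    integral_withDensity_eq_integral_toReal_smul (by fun_prop) (by simp)]
  have hpt (x : UnitAddTorus (Fin 2)) : (ENNReal.ofReal (W x)).toReal •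
      Omega.fn ⟨0, -j, j, 0, -k, k⟩ (Q x) =
      1 / 16 * ((2 * fourier j (x 0) - fourier (j - 1) (x 0) - fourier (j + 1) (x 0) : ℂ) *
        (2 * fourier k (x 1) - fourier (k - 1) (x 1) - fourier (k + 1) (x 1))) := by
    rw [ENNReal.toReal_ofReal (hW0 x), Complex.real_smul, ← norm_sub_sq_mul_cayley,
      ← norm_sub_sq_mul_cayley]
    simp only [W, Q, Omega.fn]
    push_cast
    ring
  simp only [hpt]
  rw [integral_const_mul, integral_mFourier_combination]
  simp only [hνc, Matrix.cons_val_zero, Matrix.cons_val_one]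
  -- Three values at level N + 1 in the second coordinate collapse to one at level N; `hl` then does
  -- the same in the first coordinate.
  have hr (a b : ℤ) : 4 * φ ⟨0, a, b, 0, N - k, N + k⟩ =
      2 * φ ⟨0, a, b, 0, N + 1 - k, N + 1 + k⟩ - φ ⟨0, a, b, 0, N + 1 - (k - 1), N + 1 + (k - 1)⟩ -
        φ ⟨0, a, b, 0, N + 1 - (k + 1), N + 1 + (k + 1)⟩ := by
    rw [hs.four_mul_rt]
    ring_nf
  have hl := hs.four_mul_kl 0 (N - j) (N + j) 0 (N - k) (N + k)
  rw [← hr, ← hr, ← hr]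
  have e1 : N - j + 1 = N + 1 - j := by ring
  have e2 : N + j + 1 = N + 1 + j := by ring
  have e3 : N - j + 2 = N + 1 - (j - 1) := by ring
  have e4 : N + j + 2 = N + 1 + (j + 1) := by ring
  have e5 : N - j = N + 1 - (j + 1) := by ring
  have e6 : N + j = N + 1 + (j - 1) := by ring
  rw [e1, e2, e3, e4] at hl
  rw [← e5, ← e6]
  linear_combination (-1 / 4 : ℂ) * hl

theorem fn_ofReal (N : ℤ) (x : ℝ × ℝ) : Omega.fn ⟨0, N, N, 0, N, N⟩ x =
    (((1 + x.1 ^ 2) ^ N * (1 + x.2 ^ 2) ^ N : ℝ) : ℂ) := by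
  have h (y : ℝ) : ((y : ℂ) + Complex.I) ^ N * ((y : ℂ) - Complex.I) ^ N =
      (((1 + y ^ 2) ^ N : ℝ) : ℂ) := by
    rw [← mul_zpow, Complex.ofReal_zpow]
    congr 1
    push_cast
    linear_combination -Complex.I_sq
  simp only [Omega.fn, pow_zero, one_mul, h, Complex.ofReal_mul]

theorem fn_translate (N : ℤ) (p : Omega) (x : ℝ × ℝ) :
    Omega.fn ⟨p.m, N + p.k, N + p.l, p.n, N + p.r, N + p.t⟩ x =
      ((1 + x.1 ^ 2) ^ N * (1 + x.2 ^ 2) ^ N : ℝ) • p.fn x := by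
  rw [Complex.real_smul, ← fn_ofReal]
  simp only [Omega.fn, zpow_add₀ (ofReal_add_I_ne_zero _), zpow_add₀ (ofReal_sub_I_ne_zero _)]
  ring

/-- **Solvability of the extended moment problem**: moments that satisfy the recurrences and are the
scalar products of some family have a representing measure. -/
theorem exists_isExtendedSolution {φ : Omega → ℂ} (hs : IsShiftSystem φ) {h : Omega → E}
    (hφ : IsGramFunction h φ) : ∃ μ, IsExtendedSolution φ μ := by
  choose μ hfin hμ using exists_measure_integral_cayley_eq hs hφ
  have hneg (N k l r t : ℤ) (h1 : k + l ≤ 0) (h2 : r + t ≤ 0) :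
      ∫ x, Omega.fn ⟨0, k, l, 0, r, t⟩ x ∂μ N = φ ⟨0, N + k, N + l, 0, N + r, N + t⟩ :=
    (hs.translate N).integral_fn_eq_of_nonpos (fun j k => by
      simpa only [sub_eq_add_neg] using hμ N j k) k l r t h1 h2
  -- Multiplying `μ N` by this density undoes its factor ((1 + x₁²)(1 + x₂²))ᴺ.
  let D (N : ℕ) (x : ℝ × ℝ) : ℝ := (1 + x.1 ^ 2) ^ (-N : ℤ) * (1 + x.2 ^ 2) ^ (-N : ℤ)
  have hD0 (N x) : 0 ≤ D N x := by positivity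
  have hDm (N) : Measurable (D N) := by fun_prop
  have hDi (N : ℕ) : Integrable (D N) (μ N) := by
    have := (integrable_fn_of_nonpos (μ := μ N) (-N) (-N) (-N) (-N) (by omega) (by omega)).re
    refine this.congr (.of_forall fun x => ?_)
    simp only [fn_ofReal, D]
    exact Complex.ofReal_re _
  have hD (N : ℕ) (p : Omega) (x : ℝ × ℝ) : (ENNReal.ofReal (D N x)).toReal • p.fn x =
      Omega.fn ⟨p.m, -N + p.k, -N + p.l, p.n, -N + p.r, -N + p.t⟩ x := by
    rw [ENNReal.toReal_ofReal (hD0 N x), fn_translate]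
  have hDfin (N : ℕ) : IsFiniteMeasure ((μ N).withDensity fun x => ENNReal.ofReal (D N x)) :=
    isFiniteMeasure_withDensity_ofReal (hDi N).2
  -- Both measures have the same Cayley integrals, so all the `μ N` come from the single measure `μ
  -- 0`.
  have hEq (N : ℕ) : (μ N).withDensity (fun x => ENNReal.ofReal (D N x)) = μ 0 := by
    refine measure_ext_of_integral_cayley fun j k => ?_
    rw [hμ, integral_withDensity_eq_integral_toReal_smul (by fun_prop) (by simp)]
    simp only [hD]
    rw [hneg _ _ _ _ _ (by omega) (by omega)]
    simp
  have hbase (k l r t : ℤ) : Integrable (Omega.fn ⟨0, k, l, 0, r, t⟩) (μ 0) ∧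
      ∫ x, Omega.fn ⟨0, k, l, 0, r, t⟩ x ∂μ 0 = φ ⟨0, k, l, 0, r, t⟩ := by
    -- N is large enough to make the integrand bounded after the factor D is moved into it.
    obtain ⟨N, hN1, hN2⟩ : ∃ N : ℕ, k + l ≤ N ∧ r + t ≤ N :=
      ⟨max (k + l).toNat (r + t).toNat, by omega, by omega⟩
    rw [← hEq N, integrable_withDensity_iff_integrable_smul' (by fun_prop) (by simp),
      integral_withDensity_eq_integral_toReal_smul (by fun_prop) (by simp)]
    simp only [hD]
    refine ⟨integrable_fn_of_nonpos _ _ _ _ (by omega) (by omega), ?_⟩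
    rw [hneg _ _ _ _ _ (by omega) (by omega)]
    simp
  have hm (m : ℕ) : ∀ k l r t : ℤ, Integrable (Omega.fn ⟨m, k, l, 0, r, t⟩) (μ 0) ∧
      ∫ x, Omega.fn ⟨m, k, l, 0, r, t⟩ x ∂μ 0 = φ ⟨m, k, l, 0, r, t⟩ := by
    induction m with
    | zero => exact hbase
    | succ m ih =>
      intro k l r t
      -- Powers of x₁ are reached through x₁ = (x₁ + i) - i.
      have hfn : Omega.fn ⟨m + 1, k, l, 0, r, t⟩ = fun x =>
          Omega.fn ⟨m, k + 1, l, 0, r, t⟩ x - Complex.I * Omega.fn ⟨m, k, l, 0, r, t⟩ x :=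
        funext fun x => eq_sub_of_add_eq ((isShiftSystem_fn x).shiftK m k l 0 r t)
      have i1 := ih (k + 1) l r t
      have i2 := ih k l r t
      refine ⟨hfn ▸ i1.1.sub (i2.1.const_mul _), ?_⟩
      rw [hfn, integral_sub i1.1 (i2.1.const_mul _), integral_const_mul, i1.2, i2.2,
        ← hs.shiftK m k l]
      ring
  have hn (n : ℕ) : ∀ (m : ℕ) (k l r t : ℤ), Integrable (Omega.fn ⟨m, k, l, n, r, t⟩) (μ 0) ∧
      ∫ x, Omega.fn ⟨m, k, l, n, r, t⟩ x ∂μ 0 = φ ⟨m, k, l, n, r, t⟩ := by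
    induction n with
    | zero => exact hm
    | succ n ih =>
      intro m k l r t
      have hfn : Omega.fn ⟨m, k, l, n + 1, r, t⟩ = fun x =>
          Omega.fn ⟨m, k, l, n, r + 1, t⟩ x - Complex.I * Omega.fn ⟨m, k, l, n, r, t⟩ x :=
        funext fun x => eq_sub_of_add_eq ((isShiftSystem_fn x).shiftR m k l n r t)
      have i1 := ih m k l (r + 1) t
      have i2 := ih m k l r t
      refine ⟨hfn ▸ i1.1.sub (i2.1.const_mul _), ?_⟩
      rw [hfn, integral_sub i1.1 (i2.1.const_mul _), integral_const_mul, i1.2, i2.2,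
        ← hs.shiftR m k l n]
      ring
  exact ⟨μ 0, fun p => hn p.n p.m p.k p.l p.r p.t⟩

theorem IsExtendedSolution.isFiniteMeasure {φ : Omega → ℂ} {μ : Measure (ℝ × ℝ)}
    (h : IsExtendedSolution φ μ) : IsFiniteMeasure μ := by
  have := (h ⟨0, 0, 0, 0, 0, 0⟩).1
  have h1 : Omega.fn ⟨0, 0, 0, 0, 0, 0⟩ = fun _ => (1 : ℂ) := by
    ext x; simp [Omega.fn]
  rw [h1] at this
  exact (integrable_const_iff_isFiniteMeasure one_ne_zero).1 this

theorem IsExtendedSolution.unique {φ : Omega → ℂ} {μ μ' : Measure (ℝ × ℝ)}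
    (h : IsExtendedSolution φ μ) (h' : IsExtendedSolution φ μ') : μ = μ' := by
  have := h.isFiniteMeasure
  have := h'.isFiniteMeasure
  exact measure_ext_of_integral_cayley fun j k => (h _).2.trans (h' _).2.symm

end Existence

/-! ### From parameter sequences to extensions -/

section Algorithm

variable {H : Type*} [NormedAddCommGroup H] [InnerProductSpace ℂ H]

theorem GramEq.finite_indices (E : GramEq) : E.indices.Finite := by
  cases E <;> simp only [indices] <;> exact Set.toFinite _

theorem GramEq.Holds.congr {f g : Omega → H} {E : GramEq} (h : E.Holds f)
    (hfg : ∀ p ∈ E.indices, f p = g p) : E.Holds g := by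
  cases E <;> simp only [GramEq.indices, Set.mem_insert_iff, Set.mem_singleton_iff,
    forall_eq_or_imp, forall_eq] at hfg <;> obtain ⟨h1, h2, h3, h4⟩ := hfg <;>
    simpa only [GramEq.Holds, h1, h2, h3, h4] using h

/-- All the equations of the given kinds hold as soon as scalar products are given by a function
that satisfies the recurrences. -/
theorem GramEq.holds_of_isGramFunction {h : Omega → H} {φ : Omega → ℂ} (hs : IsShiftSystem φ)
    (hφ : IsGramFunction h φ) (E : GramEq) : E.Holds h := by
  have hadd (x y z : H) : ip (x + Complex.I • y) z = ip x z + Complex.I * ip y z := by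
    simp [ip]
  have hsub (x y z : H) : ip (x - Complex.I • y) z = ip x z - Complex.I * ip y z := by
    simp [ip]
  cases E with
  | shiftK p a =>
    simp only [GramEq.Holds, hadd, hφ _ _, Omega.conjAdd]
    simpa only [add_right_comm] using hs.shiftK _ _ _ _ _ _
  | shiftL p a =>
    simp only [GramEq.Holds, hsub, hφ _ _, Omega.conjAdd]
    simpa only [add_right_comm] using hs.shiftL _ _ _ _ _ _
  | shiftR p a =>
    simp only [GramEq.Holds, hadd, hφ _ _, Omega.conjAdd]
    simpa only [add_right_comm] using hs.shiftR _ _ _ _ _ _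
  | shiftT p a =>
    simp only [GramEq.Holds, hsub, hφ _ _, Omega.conjAdd]
    simpa only [add_right_comm] using hs.shiftT _ _ _ _ _ _
  | moveM p q a b e => simp only [GramEq.Holds, hφ _ _, Omega.conjAdd, e]
  | moveKL p q a b e => simp only [GramEq.Holds, hφ _ _, Omega.conjAdd, e]
  | moveLK p q a b e => simp only [GramEq.Holds, hφ _ _, Omega.conjAdd, e]
  | moveN p q a b e => simp only [GramEq.Holds, hφ _ _, Omega.conjAdd, e]
  | moveRT p q a b e => simp only [GramEq.Holds, hφ _ _, Omega.conjAdd, e]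
  | moveTR p q a b e => simp only [GramEq.Holds, hφ _ _, Omega.conjAdd, e]

/-- The six kinds of moves, used once each, transfer all exponents of the second index to the first
and leave the zero index behind. -/
theorem isGramFunction_of_holds {h : Omega → H} (hE : ∀ E : GramEq, E.Holds h) :
    IsGramFunction h fun u => ip (h u) (h ⟨0, 0, 0, 0, 0, 0⟩) := by
  intro p q
  rcases p with ⟨m, k, l, n, r, t⟩
  rcases q with ⟨m', k', l', n', r', t'⟩
  refine (hE (.moveM ⟨m, k, l, n, r, t⟩
    ⟨m', k', l', n', r', t'⟩ (m + m') 0 rfl)).trans ?_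
  refine (hE (.moveKL ⟨m + m', k, l, n, r, t⟩
    ⟨0, k', l', n', r', t'⟩ (k + l') 0 (add_zero _).symm)).trans ?_
  refine (hE (.moveLK ⟨m + m', k + l', l, n, r, t⟩
    ⟨0, k', 0, n', r', t'⟩ (l + k') 0 (add_zero _).symm)).trans ?_
  refine (hE (.moveN ⟨m + m', k + l', l + k', n, r, t⟩
    ⟨0, 0, 0, n', r', t'⟩ (n + n') 0 rfl)).trans ?_
  refine (hE (.moveRT ⟨m + m', k + l', l + k', n + n', r, t⟩
    ⟨0, 0, 0, 0, r', t'⟩ (r + t') 0 (add_zero _).symm)).trans ?_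
  exact hE (.moveTR ⟨m + m', k + l', l + k', n + n', r + t', t⟩
    ⟨0, 0, 0, 0, r', 0⟩ (t + r') 0 (add_zero _).symm)

/-- The shift equations are only tested against members of the family. Since the difference of their
two sides lies in the span of the family, this is enough for equality of vectors. -/
theorem eq_zero_of_ip_eq_zero {h : Omega → H} {x : H} (hx : x ∈ Submodule.span ℂ (Set.range h))
    (h0 : ∀ a, ip x (h a) = 0) : x = 0 := by
  have h1 : x ∈ (Submodule.span ℂ (Set.range h))ᗮ := by
    rw [Submodule.mem_orthogonal]
    intro u hu
    induction hu using Submodule.span_induction with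
    | mem u hu => obtain ⟨a, rfl⟩ := hu; exact h0 a
    | zero => simp
    | add u v _ _ hu hv => rw [inner_add_left, hu, hv, add_zero]
    | smul c u _ hu => rw [inner_smul_left, hu, mul_zero]
  exact inner_self_eq_zero.1 ((Submodule.mem_orthogonal _ _).1 h1 x hx)

theorem add_smul_eq_of_ip_eq {h : Omega → H} {p q r : Omega} (c : ℂ)
    (h0 : ∀ a, ip (h p + c • h q) (h a) = ip (h r) (h a)) : h p + c • h q = h r := by
  have hm (a) : h a ∈ Submodule.span ℂ (Set.range h) := Submodule.subset_span ⟨a, rfl⟩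
  refine sub_eq_zero.1 (eq_zero_of_ip_eq_zero (h := h)
    (sub_mem (add_mem (hm _) (Submodule.smul_mem _ _ (hm _))) (hm _)) fun a => ?_)
  rw [ip, inner_sub_right, sub_eq_zero]
  exact h0 a

namespace ModelSpace

variable {s : ℕ → ℕ → ℂ} (S : ModelSpace s H) (w : Indexation)

theorem family_of_mem (g : ℕ → H) {p : Omega} (hp : p ∈ OmegaZero) :
    S.family w g p = S.h p.m p.n := dif_pos hp

theorem family_apply (g : ℕ → H) (j : ℕ) : S.family w g (w j).1 = g j := by
  rw [family, dif_neg (w j).2]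
  simp

theorem family_base (g : ℕ → H) (m n : ℕ) : S.family w g ⟨m, 0, 0, n, 0, 0⟩ = S.h m n :=
  S.family_of_mem w g (by simp [OmegaZero])

theorem exists_eq_apply_of_notMem {p : Omega} (hp : p ∉ OmegaZero) : ∃ j, (w j).1 = p :=
  ⟨w.symm ⟨p, hp⟩, by simp⟩

theorem tupleFamily_eq_family (g : ℕ → H) (r : ℕ) {p : Omega}
    (hp : p ∈ OmegaZero ∪ (fun j => (w j).1) '' {j | j < r}) :
    S.tupleFamily w (fun i : Fin r => g i) p = S.family w g p := by
  by_cases h0 : p ∈ OmegaZero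
  · rw [tupleFamily, family_of_mem _ _ _ h0, family_of_mem _ _ _ h0]
  · obtain ⟨j, hj, rfl⟩ := hp.resolve_left h0
    simp only [tupleFamily, family_apply]
    exact dif_pos hj

variable {S w} {κ : ℕ ≃ ℕ × ℕ} {M : ℕ → ℝ}

theorem mem_G_iff {g : ℕ → H} {r : ℕ} : (fun i : Fin r => g i) ∈ S.G κ w M r ↔
    ∀ j < r, S.Step κ w M j (fun i : Fin (j + 1) => g i) := by
  induction r with
  | zero => simp [G]
  | succ r ih =>
    rw [Nat.forall_lt_succ_right, ← ih]
    rfl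

theorem step_of_mem_paramSet {g : ℕ → H} (hg : g ∈ S.paramSet κ w M) (r : ℕ) :
    S.Step κ w M r (fun i : Fin (r + 1) => g i) :=
  mem_G_iff.1 (Set.mem_iInter.1 hg r).2.1 r r.lt_succ_self

theorem holds_family (h0 : S.StepZero w) {g : ℕ → H}
    (hg : ∀ r, S.Step κ w M r (fun i : Fin (r + 1) => g i)) (E : GramEq) :
    E.Holds (S.family w g) := by
  by_cases hE : E.indices ⊆ OmegaZero
  · refine (h0 E hE).congr fun p hp => ?_
    rw [tupleFamily, family_of_mem _ _ _ (hE hp), family_of_mem _ _ _ (hE hp)]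
  · obtain ⟨p, hp, hp0⟩ := Set.not_subset.1 hE
    obtain ⟨j₀, rfl⟩ := exists_eq_apply_of_notMem w hp0
    have hfin : {j | (w j).1 ∈ E.indices}.Finite :=
      E.finite_indices.preimage (Subtype.val_injective.comp w.injective).injOn
    -- The last index outside Ω₀ that the equation contains; step r imposes the equation.
    obtain ⟨r, hr, hmax⟩ := hfin.exists_maximal ⟨j₀, hp⟩
    have hsub : E.indices ⊆ OmegaZero ∪ (fun j => (w j).1) '' {j | j ≤ r} := by
      intro p hp
      by_cases h : p ∈ OmegaZero
      · exact .inl h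
      · obtain ⟨j, rfl⟩ := exists_eq_apply_of_notMem w h
        exact .inr ⟨j, (le_total j r).elim id fun hj => hmax hp hj, rfl⟩
    refine ((hg r).2 E hr hsub).congr fun p hp => S.tupleFamily_eq_family w g (r + 1) ?_
    simpa only [Nat.lt_succ_iff] using hsub hp

theorem gs_mem_H₀ (i : ℕ) : S.gs κ i ∈ S.H₀ := by
  refine Submodule.le_topologicalClosure _ ?_
  have h1 : S.gs κ i ∈ Submodule.span ℂ (Set.range (S.gs κ)) := Submodule.subset_span ⟨i, rfl⟩
  rw [gs, InnerProductSpace.span_gramSchmidtNormed_range, InnerProductSpace.span_gramSchmidt] at h1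
  refine Submodule.span_mono ?_ h1
  rintro _ ⟨i, rfl⟩
  exact ⟨κ i, rfl⟩

theorem inner_e_of_mem_H₀ (j : ℕ) {x : H} (hx : x ∈ S.H₀) : inner ℂ (S.e j) x = 0 := by
  have h1 : S.H₀ ≤ (ℂ ∙ S.e j)ᗮ := by
    refine Submodule.topologicalClosure_minimal _ ?_ (Submodule.isClosed_orthogonal _)
    rw [Submodule.span_le]
    rintro _ ⟨p, rfl⟩
    rw [SetLike.mem_coe, Submodule.mem_orthogonal_singleton_iff_inner_left]
    exact S.orthogonal j p.1 p.2
  exact Submodule.mem_orthogonal_singleton_iff_inner_right.1 (h1 hx)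

theorem isExtension_family (h0 : S.StepZero w) {g : ℕ → H} (hg : g ∈ S.paramSet κ w M) :
    S.IsExtension w (S.family w g) := by
  have hstep := step_of_mem_paramSet hg
  have hE := holds_family h0 hstep
  refine ⟨S.family_base w g, ⟨Set.univ, fun r => ?_⟩,
    fun p => add_smul_eq_of_ip_eq _ fun a => hE (.shiftK p a), fun p => ?_,
    fun p => add_smul_eq_of_ip_eq _ fun a => hE (.shiftR p a), fun p => ?_,
    _, isGramFunction_of_holds hE⟩
  · obtain ⟨⟨α, β, d, -, -, -, hv⟩, -⟩ := hstep r
    simp only [Fin.val_last] at hv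
    have hα : ∑' i, α i • S.gs κ i ∈ S.H₀ :=
      tsum_mem (Submodule.isClosed_topologicalClosure _)
        fun i => Submodule.smul_mem _ _ (gs_mem_H₀ _)
    have he (j : ℕ) (hj : j ≤ r) :
        S.e j ∈ S.H₀ ⊔ Submodule.span ℂ (S.e '' {j | j ∈ Set.univ ∧ j ≤ r}) :=
      Submodule.mem_sup_right (Submodule.subset_span ⟨j, ⟨trivial, hj⟩, rfl⟩)
    -- Everything else in the step is orthogonal to e_r, so the coefficient is the square root and
    -- hence non-negative.
    have hip : ip (g r) (S.e r) = (Real.sqrt (d - ∑' i, ‖α i‖ ^ 2 - ∑ j, ‖β j‖ ^ 2) : ℝ) := by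
      have horth (j : Fin r) : inner ℂ (S.e r) (S.e j) = 0 := S.orthonormal.2 j.2.ne'
      have hone : inner ℂ (S.e r) (S.e r) = 1 := by
        rw [inner_self_eq_norm_sq_to_K, S.orthonormal.1]; simp
      rw [hv, ip, inner_add_right, inner_add_right, inner_e_of_mem_H₀ r hα, inner_sum,
        inner_smul_right, hone]
      simp [inner_smul_right, horth]
    rw [family_apply, hip]
    refine ⟨?_, by simp [Real.sqrt_nonneg], by simp⟩
    rw [hv]
    exact add_mem (add_mem (Submodule.mem_sup_left hα) (sum_mem fun j _ =>
      Submodule.smul_mem _ _ (he j j.2.le))) (Submodule.smul_mem _ _ (he r le_rfl))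
  · rw [sub_eq_add_neg, ← neg_smul]
    refine add_smul_eq_of_ip_eq _ fun a => ?_
    rw [neg_smul, ← sub_eq_add_neg]
    exact hE (.shiftL p a)
  · rw [sub_eq_add_neg, ← neg_smul]
    refine add_smul_eq_of_ip_eq _ fun a => ?_
    rw [neg_smul, ← sub_eq_add_neg]
    exact hE (.shiftT p a)

/-- Pairing with the vector of index zero recovers φ, so linear relations between the vectors pass
to φ. -/
theorem IsExtension.isShiftSystem {h : Omega → H} (hX : S.IsExtension w h) {φ : Omega → ℂ}
    (hφ : IsGramFunction h φ) : IsShiftSystem φ := by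
  have h0 (u : Omega) : φ u = ip (h u) (h ⟨0, 0, 0, 0, 0, 0⟩) := by
    rw [hφ]; simp [Omega.conjAdd]
  constructor <;> intro m k l n r t <;> simp only [h0]
  · rw [← hX.shiftK ⟨m, k, l, n, r, t⟩]
    simp [ip]
  · rw [← hX.shiftL ⟨m, k, l, n, r, t⟩]
    simp [ip]
  · rw [← hX.shiftR ⟨m, k, l, n, r, t⟩]
    simp [ip]
  · rw [← hX.shiftT ⟨m, k, l, n, r, t⟩]
    simp [ip]

theorem IsExtension.isPlaneSolution {h : Omega → H} (hX : S.IsExtension w h) {φ : Omega → ℂ}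
    (hφ : IsGramFunction h φ) {μ : Measure (ℝ × ℝ)} (hμ : IsExtendedSolution φ μ) :
    IsPlaneSolution s μ := by
  intro m n
  have h1 := hφ ⟨m, 0, 0, n, 0, 0⟩ ⟨0, 0, 0, 0, 0, 0⟩
  rw [hX.base, hX.base, S.gram] at h1
  simp only [Omega.conjAdd, add_zero] at h1
  have h2 := hμ ⟨m, 0, 0, n, 0, 0⟩
  have h3 : Omega.fn ⟨m, 0, 0, n, 0, 0⟩ = fun x => (x.1 : ℂ) ^ m * (x.2 : ℂ) ^ n := by
    ext x
    simp [Omega.fn]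
  rwa [← h1, h3] at h2

end ModelSpace

end Algorithm

/-! ### Isometries, Cholesky factors and the basis of a model space -/

section Gram

open InnerProductSpace

variable {F H : Type*} [NormedAddCommGroup F] [InnerProductSpace ℂ F]
  [NormedAddCommGroup H] [InnerProductSpace ℂ H]

theorem norm_eq_of_inner_self_eq {x : F} {y : H} (h : inner ℂ x x = inner ℂ y y) : ‖x‖ = ‖y‖ := by
  rw [@norm_eq_sqrt_re_inner ℂ, @norm_eq_sqrt_re_inner ℂ H, h]

/-- Families with the same scalar products are related by an isometry of their closed spans. -/
theorem exists_linearIsometry_of_inner_eq [CompleteSpace H] {ι : Type*} {x : ι → F} {z : ι → H}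
    (hxz : ∀ i j, inner ℂ (x i) (x j) = inner ℂ (z i) (z j)) :
    ∃ V : (Submodule.span ℂ (Set.range x)).topologicalClosure →ₗᵢ[ℂ] H,
      (∀ i hi, V ⟨x i, hi⟩ = z i) ∧
        ∀ a, V a ∈ (Submodule.span ℂ (Set.range z)).topologicalClosure := by
  set K := (Submodule.span ℂ (Set.range x)).topologicalClosure with hK
  have hmem (c : ι →₀ ℂ) : Finsupp.linearCombination ℂ x c ∈ Submodule.span ℂ (Set.range x) := by
    rw [← Finsupp.range_linearCombination]; exact ⟨c, rfl⟩
  let e : (ι →₀ ℂ) →ₗ[ℂ] K := (Finsupp.linearCombination ℂ x).codRestrict K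
    fun c => Submodule.le_topologicalClosure _ (hmem c)
  have hdense : DenseRange e := by
    rw [DenseRange, Subtype.dense_iff]
    intro y hy
    refine closure_mono ?_ hy
    intro y hy
    rw [SetLike.mem_coe, ← Finsupp.range_linearCombination] at hy
    obtain ⟨c, rfl⟩ := hy
    exact ⟨e c, ⟨c, rfl⟩, rfl⟩
  have hnorm (c : ι →₀ ℂ) : ‖Finsupp.linearCombination ℂ z c‖ = ‖e c‖ := by
    refine norm_eq_of_inner_self_eq ?_
    change _ = inner ℂ (Finsupp.linearCombination ℂ x c) (Finsupp.linearCombination ℂ x c)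
    simp only [Finsupp.linearCombination_apply, Finsupp.sum, sum_inner, inner_sum, hxz,
      inner_smul_left, inner_smul_right]
  -- Equal Gram matrices give equal norms of combinations, so the assignment respects linear
  -- relations and extends from the dense range of `e`.
  let T := (Finsupp.linearCombination ℂ z).extendOfNorm e
  have hT (c : ι →₀ ℂ) : T (e c) = Finsupp.linearCombination ℂ z c :=
    LinearMap.extendOfNorm_eq hdense ⟨1, fun c => by rw [one_mul, hnorm]⟩ c
  have hTn (a : K) : ‖T a‖ = ‖a‖ := hdense.induction_on (p := fun a => ‖T a‖ = ‖a‖) a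
    (isClosed_eq (by fun_prop) (by fun_prop)) fun c => by rw [hT, hnorm]
  refine ⟨⟨T.toLinearMap, hTn⟩, fun i hi => ?_, fun a => ?_⟩
  · have h1 : (⟨x i, hi⟩ : K) = e (Finsupp.single i 1) := Subtype.ext (by simp [e])
    change T _ = _
    rw [h1, hT]
    simp
  · refine hdense.induction_on
      (p := fun a => T a ∈ (Submodule.span ℂ (Set.range z)).topologicalClosure) a
      ((Submodule.isClosed_topologicalClosure _).preimage T.continuous) fun c => ?_
    rw [hT]
    refine Submodule.le_topologicalClosure _ ?_
    rw [← Finsupp.range_linearCombination]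
    exact ⟨c, rfl⟩

theorem inner_gramSchmidt_self (f : ℕ → F) (r : ℕ) :
    inner ℂ (gramSchmidt ℂ f r) (f r) = (‖gramSchmidt ℂ f r‖ : ℂ) ^ 2 := by
  conv_lhs => rw [gramSchmidt_def'' ℂ f r]
  rw [inner_add_right, inner_sum, Finset.sum_eq_zero fun i hi => ?_, add_zero,
    ← ofReal_norm_sq_eq_inner, Complex.ofReal_pow]
  rw [inner_smul_right, gramSchmidt_orthogonal ℂ f (Finset.mem_Iio.1 hi).ne', mul_zero]

/-- Linear dependence is allowed: a vanishing Gram–Schmidt vector has normalization 0 and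
contributes nothing. -/
theorem sum_inner_gramSchmidtNormed (f : ℕ → F) {r N : ℕ} (h : r < N) :
    ∑ j ∈ Finset.range N, (inner ℂ (gramSchmidtNormed ℂ f j) (f r) : ℂ) • gramSchmidtNormed ℂ f j =
      f r := by
  have hterm (j : ℕ) : (inner ℂ (gramSchmidtNormed ℂ f j) (f r) : ℂ) • gramSchmidtNormed ℂ f j =
      (inner ℂ (gramSchmidt ℂ f j) (f r) / (‖gramSchmidt ℂ f j‖ : ℂ) ^ 2) • gramSchmidt ℂ f j := by
    rw [gramSchmidtNormed, inner_smul_left, smul_smul]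
    congr 1
    simp only [map_inv₀, Complex.conj_ofReal, Complex.coe_algebraMap]
    ring
  have hrr : (inner ℂ (gramSchmidt ℂ f r) (f r) / (‖gramSchmidt ℂ f r‖ : ℂ) ^ 2) •
      gramSchmidt ℂ f r = gramSchmidt ℂ f r := by
    by_cases h0 : gramSchmidt ℂ f r = 0
    · rw [h0, smul_zero]
    · rw [inner_gramSchmidt_self, div_self, one_smul]
      simpa using h0
  conv_rhs => rw [gramSchmidt_def'' ℂ f r]
  simp only [hterm]
  rw [← Finset.sum_subset (s₁ := Finset.range (r + 1)) (Finset.range_subset_range.2 h)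
    (fun j _ hj => by
      rw [gramSchmidt_inv_triangular ℂ f (by simpa [Nat.lt_succ_iff] using hj)]; simp),
    Finset.sum_range_succ, hrr, add_comm, Nat.Iio_eq_range]
  simp

/-- **Cholesky factorization** of a Gram matrix. -/
theorem exists_cholesky (f : ℕ → F) : ∃ (b : ℕ → ℕ → ℂ) (c : ℕ → ℝ), (∀ r, 0 ≤ c r ∧ b r r = c r) ∧
    (∀ r j, r < j → b r j = 0) ∧
    ∀ q r, ∑ j ∈ Finset.range (r + 1), starRingEnd ℂ (b q j) * b r j = inner ℂ (f q) (f r) := by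
  -- The entries are the Gram–Schmidt coordinates of f r; the diagonal is the norm of the
  -- unnormalized Gram–Schmidt vector.
  refine ⟨fun r j => inner ℂ (gramSchmidtNormed ℂ f j) (f r), fun r => ‖gramSchmidt ℂ f r‖,
    fun r => ⟨norm_nonneg _, ?_⟩, fun r j hj => ?_, fun q r => ?_⟩
  · change inner ℂ (gramSchmidtNormed ℂ f r) (f r) = (‖gramSchmidt ℂ f r‖ : ℂ)
    rw [gramSchmidtNormed, inner_smul_left, inner_gramSchmidt_self, map_inv₀, RCLike.conj_ofReal]
    change (‖gramSchmidt ℂ f r‖ : ℂ)⁻¹ * (‖gramSchmidt ℂ f r‖ : ℂ) ^ 2 = _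
    by_cases h0 : (‖gramSchmidt ℂ f r‖ : ℂ) = 0
    · simp [h0]
    · field_simp
  · simp only [gramSchmidtNormed, inner_smul_left, gramSchmidt_inv_triangular ℂ f hj, mul_zero]
  · conv_rhs => rw [← sum_inner_gramSchmidtNormed f r.lt_succ_self]
    simp only [inner_sum, inner_smul_right, inner_conj_symm]
    exact Finset.sum_congr rfl fun j _ => mul_comm _ _

namespace ModelSpace

variable {s : ℕ → ℕ → ℂ} (S : ModelSpace s H) (κ : ℕ ≃ ℕ × ℕ)

/-- The orthonormal basis of a model space that consists of the `g_n` and the `e_j`. -/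
theorem exists_hilbertBasis [CompleteSpace H] : ∃ B : HilbertBasis (S.BasisIndex κ ⊕ ℕ) ℂ H,
    (B : S.BasisIndex κ ⊕ ℕ → H) = Sum.elim (fun i : S.BasisIndex κ => S.gs κ i) S.e := by
  have hgs : Orthonormal ℂ fun i : S.BasisIndex κ => S.gs κ i := gramSchmidtNormed_orthonormal' _
  have hge (i : S.BasisIndex κ) (j : ℕ) : inner ℂ (S.e j) (S.gs κ i) = 0 :=
    inner_e_of_mem_H₀ j (gs_mem_H₀ _)
  have horth : Orthonormal ℂ (Sum.elim (fun i : S.BasisIndex κ => S.gs κ i) S.e) := by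
    constructor
    · rintro (i | j)
      · exact hgs.1 i
      · exact S.orthonormal.1 j
    · rintro (i | j) (i' | j') h
      · exact hgs.2 fun h' => h (by rw [h'])
      · exact inner_eq_zero_symm.1 (hge i j')
      · exact hge i' j
      · exact S.orthonormal.2 fun h' => h (by rw [h'])
  refine ⟨HilbertBasis.mk horth ?_, HilbertBasis.coe_mk _ _⟩
  rw [← S.total]
  refine Submodule.topologicalClosure_mono ?_
  rw [Submodule.span_le]
  have hspan : Submodule.span ℂ (Set.range fun p : ℕ × ℕ => S.h p.1 p.2) ≤
      Submodule.span ℂ (Set.range (Sum.elim (fun i : S.BasisIndex κ => S.gs κ i) S.e)) := by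
    have h1 : Set.range (fun p : ℕ × ℕ => S.h p.1 p.2) =
        Set.range (fun i => S.h (κ i).1 (κ i).2) :=
      (κ.surjective.range_comp (fun p : ℕ × ℕ => S.h p.1 p.2)).symm
    rw [h1, ← span_gramSchmidt, ← span_gramSchmidtNormed_range, Submodule.span_le]
    rintro _ ⟨i, rfl⟩
    by_cases hi : S.gs κ i = 0
    · change S.gs κ i ∈ _
      rw [hi]; exact zero_mem _
    · exact Submodule.subset_span ⟨.inl ⟨i, hi⟩, rfl⟩
  rintro _ (⟨p, rfl⟩ | ⟨j, rfl⟩)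
  · exact hspan (Submodule.subset_span ⟨p, rfl⟩)
  · exact Submodule.subset_span ⟨.inr j, rfl⟩

theorem hasSum_gs_of_mem_H₀ [CompleteSpace H] {v : H} (hv : v ∈ S.H₀) :
    HasSum (fun i : S.BasisIndex κ => (inner ℂ (S.gs κ i) v : ℂ) • S.gs κ i) v ∧
      HasSum (fun i : S.BasisIndex κ => ‖(inner ℂ (S.gs κ i) v : ℂ)‖ ^ 2) (‖v‖ ^ 2) := by
  obtain ⟨B, hB⟩ := S.exists_hilbertBasis κ
  have he (j : ℕ) : inner ℂ (B (.inr j)) v = 0 := by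
    rw [hB]; exact inner_e_of_mem_H₀ j hv
  have h1 := B.hasSum_repr v
  have h2 := Complex.hasSum_re (B.hasSum_inner_mul_inner v v)
  simp only [B.repr_apply_apply] at h1
  rw [← Sum.inl_injective.hasSum_iff] at h1 h2
  · refine ⟨?_, ?_⟩
    · simpa [hB, Function.comp_def] using h1
    · convert h2 using 1
      · ext i
        simp only [Function.comp_apply, hB, Sum.elim_inl]
        rw [← inner_conj_symm v, mul_comm, Complex.mul_conj, Complex.normSq_eq_norm_sq,
          Complex.ofReal_re]
      · rw [← ofReal_norm_sq_eq_inner, Complex.ofReal_re]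
  all_goals
    rintro (i | j) hj
    · exact absurd ⟨i, rfl⟩ hj
    · simp [he]

/-- With d = ‖x‖², Parseval in H₀ and Pythagoras leave c² under the root, and c ≥ 0 makes the root
equal to c. -/
theorem exists_step_coefficients [CompleteSpace H] {v x : H} (hv : v ∈ S.H₀) {b : ℕ → ℂ} {r : ℕ}
    {c M : ℝ} (hc : 0 ≤ c) (hbc : b r = c)
    (hx : x = v + ∑ j ∈ Finset.range (r + 1), b j • S.e j) (hM : ‖x‖ ^ 2 ≤ M) :
    ∃ (α : S.BasisIndex κ → ℂ) (β : Fin r → ℂ) (d : ℝ),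
      Summable (fun i => ‖α i‖ ^ 2) ∧ ∑' i, ‖α i‖ ^ 2 + ∑ j, ‖β j‖ ^ 2 ≤ d ∧ d ≤ M ∧
      x = ∑' i, α i • S.gs κ i + ∑ j : Fin r, β j • S.e j +
        ((Real.sqrt (d - ∑' i, ‖α i‖ ^ 2 - ∑ j, ‖β j‖ ^ 2) : ℝ) : ℂ) • S.e r := by
  obtain ⟨h1, h2⟩ := S.hasSum_gs_of_mem_H₀ κ hv
  have horth : inner ℂ (∑ j ∈ Finset.range (r + 1), b j • S.e j) v = 0 := by
    rw [sum_inner]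
    exact Finset.sum_eq_zero fun j _ => by rw [inner_smul_left, inner_e_of_mem_H₀ j hv, mul_zero]
  have hnorm : ‖x‖ ^ 2 = ‖v‖ ^ 2 + ∑ j : Fin r, ‖b j‖ ^ 2 + c ^ 2 := by
    have h3 : ‖∑ j ∈ Finset.range (r + 1), b j • S.e j‖ ^ 2 =
        ∑ j : Fin r, ‖b j‖ ^ 2 + c ^ 2 := by
      rw [← Complex.ofReal_inj, ofReal_norm_sq_eq_inner, S.orthonormal.inner_sum,
        Finset.sum_range_succ, hbc, ← Fin.sum_univ_eq_sum_range]
      simp [Complex.conj_mul', sq]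
    rw [add_assoc, ← h3, hx, sq, sq, sq,
      norm_add_sq_eq_norm_sq_add_norm_sq_of_inner_eq_zero _ _ (inner_eq_zero_symm.1 horth)]
  refine ⟨fun i => inner ℂ (S.gs κ i) v, fun j => b j, ‖x‖ ^ 2, h2.summable, ?_, hM, ?_⟩
  · rw [h2.tsum_eq, hnorm]
    nlinarith
  · rw [h2.tsum_eq, h1.tsum_eq, hnorm, show ‖v‖ ^ 2 + ∑ j : Fin r, ‖b j‖ ^ 2 + c ^ 2 - ‖v‖ ^ 2 -
      ∑ j : Fin r, ‖b j‖ ^ 2 = c ^ 2 by ring, Real.sqrt_sq hc, ← hbc, hx, Finset.sum_range_succ,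
      ← Fin.sum_univ_eq_sum_range (fun j => b j • S.e j), add_assoc]

end ModelSpace

end Gram

/-! ### From a solution to a parameter sequence -/

section PlaneMoments

variable {s : ℕ → ℕ → ℂ} {μ : Measure (ℝ × ℝ)}

theorem fn_base (m n : ℕ) :
    Omega.fn ⟨m, 0, 0, n, 0, 0⟩ = fun x => (x.1 : ℂ) ^ m * (x.2 : ℂ) ^ n := by
  ext x
  simp [Omega.fn]

/-- All the functions `fn` are integrable for a solution of the two-dimensional moment problem. -/
theorem IsPlaneSolution.integrable_fn (hμ : IsPlaneSolution s μ) (p : Omega) :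
    Integrable p.fn μ := by
  have hk (K : ℕ) : ∀ m n : ℕ, Integrable (Omega.fn ⟨m, K, 0, n, 0, 0⟩) μ := by
    induction K with
    | zero => exact fun m n => by simpa only [Nat.cast_zero, fn_base] using (hμ m n).1
    | succ K ih =>
      intro m n
      have h1 : Omega.fn ⟨m, (K + 1 : ℕ), 0, n, 0, 0⟩ = fun x =>
          Omega.fn ⟨m + 1, K, 0, n, 0, 0⟩ x + Complex.I * Omega.fn ⟨m, K, 0, n, 0, 0⟩ x :=
        funext fun x => ((isShiftSystem_fn x).shiftK m K 0 n 0 0).symm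
      exact h1 ▸ (ih (m + 1) n).add ((ih m n).const_mul _)
  have hr (J : ℕ) : ∀ K m n : ℕ, Integrable (Omega.fn ⟨m, K, 0, n, J, 0⟩) μ := by
    induction J with
    | zero => exact hk
    | succ J ih =>
      intro K m n
      have h1 : Omega.fn ⟨m, K, 0, n, (J + 1 : ℕ), 0⟩ = fun x =>
          Omega.fn ⟨m, K, 0, n + 1, J, 0⟩ x + Complex.I * Omega.fn ⟨m, K, 0, n, J, 0⟩ x :=
        funext fun x => ((isShiftSystem_fn x).shiftR m K 0 n J 0).symm
      exact h1 ▸ (ih K m (n + 1)).add ((ih K m n).const_mul _)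
  -- Only the sums k + l and r + t affect the modulus; replacing them by their positive parts gives
  -- an integrable majorant, since √(1 + y²) ≥ 1.
  refine (hr (p.r + p.t).toNat (p.k + p.l).toNat p.m p.n).mono
    (continuous_fn p).aestronglyMeasurable (.of_forall fun x => ?_)
  have h (y : ℝ) : 1 ≤ Real.sqrt (1 + y ^ 2) := Real.one_le_sqrt.2 (by nlinarith [sq_nonneg y])
  rw [norm_fn, norm_fn]
  have hz (y : ℝ) (k : ℤ) :
      Real.sqrt (1 + y ^ 2) ^ k ≤ Real.sqrt (1 + y ^ 2) ^ ((k.toNat : ℤ) + 0) :=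
    zpow_le_zpow_right₀ (h y) (by omega)
  exact mul_le_mul (mul_le_mul_of_nonneg_left (hz _ _) (by positivity))
    (mul_le_mul_of_nonneg_left (hz _ _) (by positivity)) (by positivity) (by positivity)

theorem IsPlaneSolution.memLp_fn (hμ : IsPlaneSolution s μ) (p : Omega) : MemLp p.fn 2 μ := by
  rw [memLp_two_iff_integrable_sq_norm (continuous_fn p).aestronglyMeasurable]
  refine (hμ.integrable_fn (p.conjAdd p)).norm.congr (.of_forall fun x => ?_)
  simp only [fn_conjAdd, norm_mul, RCLike.norm_conj, sq]

/-- The functions `fn` as elements of `L²`. -/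
def IsPlaneSolution.toLp (hμ : IsPlaneSolution s μ) (p : Omega) : Lp ℂ 2 μ := (hμ.memLp_fn p).toLp

theorem IsPlaneSolution.inner_toLp (hμ : IsPlaneSolution s μ) (p q : Omega) :
    inner ℂ (hμ.toLp q) (hμ.toLp p) = ∫ x, (p.conjAdd q).fn x ∂μ := by
  rw [L2.inner_def]
  refine integral_congr_ae ?_
  filter_upwards [(hμ.memLp_fn p).coeFn_toLp, (hμ.memLp_fn q).coeFn_toLp] with x hp hq
  rw [toLp, toLp, hp, hq, fn_conjAdd, RCLike.inner_apply]

theorem IsPlaneSolution.isShiftSystem (hμ : IsPlaneSolution s μ) :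
    IsShiftSystem fun p => ∫ x, p.fn x ∂μ := by
  constructor <;> intro m k l n r t <;> rw [← integral_const_mul]
  · rw [← integral_add (hμ.integrable_fn _) ((hμ.integrable_fn _).const_mul _)]
    simp only [(isShiftSystem_fn _).shiftK]
  · rw [← integral_sub (hμ.integrable_fn _) ((hμ.integrable_fn _).const_mul _)]
    simp only [(isShiftSystem_fn _).shiftL]
  · rw [← integral_add (hμ.integrable_fn _) ((hμ.integrable_fn _).const_mul _)]
    simp only [(isShiftSystem_fn _).shiftR]
  · rw [← integral_sub (hμ.integrable_fn _) ((hμ.integrable_fn _).const_mul _)]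
    simp only [(isShiftSystem_fn _).shiftT]

variable {H : Type*} [NormedAddCommGroup H] [InnerProductSpace ℂ H] [CompleteSpace H]

namespace ModelSpace

/-- The functions `fn` of a solution of the moment problem can be modelled by a family in triangular
form with respect to the vectors `e_j`. -/
theorem exists_triangular_model (S : ModelSpace s H) (w : Indexation) (hμ : IsPlaneSolution s μ) :
    ∃ g v : ℕ → H, ∃ b : ℕ → ℕ → ℂ, ∃ c : ℕ → ℝ, (∀ r, v r ∈ S.H₀) ∧
      (∀ r, 0 ≤ c r ∧ b r r = c r) ∧
      (∀ r, g r = v r + ∑ j ∈ Finset.range (r + 1), b r j • S.e j) ∧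
      IsGramFunction (S.family w g) fun p => ∫ x, p.fn x ∂μ := by
  have hbase (i j : ℕ × ℕ) : inner ℂ (hμ.toLp ⟨i.1, 0, 0, i.2, 0, 0⟩)
      (hμ.toLp ⟨j.1, 0, 0, j.2, 0, 0⟩) = inner ℂ (S.h i.1 i.2) (S.h j.1 j.2) := by
    rw [hμ.inner_toLp]
    simp only [Omega.conjAdd, add_zero, fn_base]
    rw [(hμ _ _).2, ← S.gram, ip]
  let K := (Submodule.span ℂ (Set.range fun i : ℕ × ℕ =>
    hμ.toLp ⟨i.1, 0, 0, i.2, 0, 0⟩)).topologicalClosure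
  obtain ⟨V, hVx, hVmem⟩ : ∃ V : K →ₗᵢ[ℂ] H,
      (∀ (i : ℕ × ℕ) hi, V ⟨hμ.toLp ⟨i.1, 0, 0, i.2, 0, 0⟩, hi⟩ = S.h i.1 i.2) ∧
        ∀ a, V a ∈ S.H₀ := exists_linearIsometry_of_inner_eq hbase
  have : CompleteSpace K := (Submodule.isClosed_topologicalClosure _).completeSpace_coe
  let y (r : ℕ) : Lp ℂ 2 μ := hμ.toLp (w r).1
  let P (r : ℕ) : K := ⟨K.starProjection (y r), K.starProjection_apply_mem _⟩
  have horth (r : ℕ) (a : K) : inner ℂ (a : Lp ℂ 2 μ) (y r - K.starProjection (y r)) = 0 :=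
    (Submodule.mem_orthogonal _ _).1 (K.sub_starProjection_mem_orthogonal (y r)) a a.2
  -- Only the residuals orthogonal to the polynomials are factored; the projections are transported
  -- by V.
  obtain ⟨b, c, hbc, hb0, hbf⟩ := exists_cholesky fun r => y r - K.starProjection (y r)
  have hVe (a : K) (f : ℕ → ℂ) (N : ℕ) :
      inner ℂ (V a) (∑ j ∈ Finset.range N, f j • S.e j) = 0 := by
    rw [inner_sum]
    refine Finset.sum_eq_zero fun j _ => ?_
    rw [inner_smul_right, inner_eq_zero_symm.1 (inner_e_of_mem_H₀ j (hVmem a)), mul_zero]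
  let g (r : ℕ) : H := V (P r) + ∑ j ∈ Finset.range (r + 1), b r j • S.e j
  have hag (a : K) (r : ℕ) : inner ℂ (V a) (g r) = inner ℂ (a : Lp ℂ 2 μ) (y r) := by
    rw [inner_add_right, hVe, add_zero, V.inner_map_map, ← sub_eq_zero, ← neg_sub, neg_eq_zero,
      ← horth r a, inner_sub_right]
    rfl
  -- Row r of b vanishes beyond column r. For r ≤ q the e_j-parts thus have common support in j ≤ r,
  -- where the Cholesky identity applies; the other order follows by conjugation.
  have hgle (q r : ℕ) (hqr : r ≤ q) : inner ℂ (g q) (g r) = inner ℂ (y q) (y r) := by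
    have h1 : ∑ j ∈ Finset.range (r + 1), b r j • S.e j =
        ∑ j ∈ Finset.range (q + 1), b r j • S.e j :=
      Finset.sum_subset (Finset.range_subset_range.2 (by omega)) fun j _ hj => by
        rw [hb0 r j (by simpa [Nat.lt_succ_iff] using hj), zero_smul]
    have h2 : ∑ j ∈ Finset.range (q + 1), starRingEnd ℂ (b q j) * b r j =
        ∑ j ∈ Finset.range (r + 1), starRingEnd ℂ (b q j) * b r j :=
      (Finset.sum_subset (Finset.range_subset_range.2 (by omega)) fun j _ hj => by
        rw [hb0 r j (by simpa [Nat.lt_succ_iff] using hj), mul_zero]).symm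
    have h3 : inner ℂ (g q) (g r) = inner ℂ (K.starProjection (y q)) (y r) +
        inner ℂ (y q - K.starProjection (y q)) (y r - K.starProjection (y r)) := by
      conv_lhs => rw [show g q = V (P q) + ∑ j ∈ Finset.range (q + 1), b q j • S.e j from rfl,
        inner_add_left, hag]
      congr 1
      rw [show g r = V (P r) + ∑ j ∈ Finset.range (r + 1), b r j • S.e j from rfl,
        inner_add_right, inner_eq_zero_symm.1 (hVe _ _ _), zero_add, h1, S.orthonormal.inner_sum,
        h2, hbf]
    have h4 := horth r (P q)
    have h5 := inner_eq_zero_symm.1 (horth q (P r))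
    simp only [P] at h4 h5
    rw [h3, inner_sub_right (y q - _), h5, sub_zero, inner_sub_left]
    ring
  have hgg (q r : ℕ) : inner ℂ (g q) (g r) = inner ℂ (y q) (y r) := by
    rcases le_total r q with h | h
    · exact hgle q r h
    · rw [← inner_conj_symm, hgle r q h, inner_conj_symm]
  refine ⟨g, fun r => V (P r), b, c, fun r => hVmem _, hbc, fun r => rfl, fun p q => ?_⟩
  have hbg (m n r : ℕ) : inner ℂ (S.h m n) (g r) = inner ℂ (hμ.toLp ⟨m, 0, 0, n, 0, 0⟩) (y r) := by
    have hm : hμ.toLp ⟨m, 0, 0, n, 0, 0⟩ ∈ K :=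
      Submodule.le_topologicalClosure _ (Submodule.subset_span ⟨(m, n), rfl⟩)
    rw [← hVx (m, n) hm, hag]
  refine Eq.trans ?_ (hμ.inner_toLp p q)
  rw [ip]
  have hz {p : Omega} (hp : p ∈ OmegaZero) : p = ⟨p.m, 0, 0, p.n, 0, 0⟩ := by
    obtain ⟨m, k, l, n, r, t⟩ := p
    obtain ⟨rfl, rfl, rfl, rfl⟩ := hp
    rfl
  by_cases hp : p ∈ OmegaZero <;> by_cases hq : q ∈ OmegaZero
  · rw [S.family_of_mem w g hp, S.family_of_mem w g hq, hz hp, hz hq]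
    exact (hbase (q.m, q.n) (p.m, p.n)).symm
  · obtain ⟨r, rfl⟩ := exists_eq_apply_of_notMem w hq
    rw [S.family_of_mem w g hp, S.family_apply, hz hp, ← inner_conj_symm, hbg, inner_conj_symm]
  · obtain ⟨r, rfl⟩ := exists_eq_apply_of_notMem w hp
    rw [S.family_of_mem w g hq, S.family_apply, hz hq, hbg]
  · obtain ⟨r, rfl⟩ := exists_eq_apply_of_notMem w hp
    obtain ⟨r', rfl⟩ := exists_eq_apply_of_notMem w hq
    rw [S.family_apply, S.family_apply, hgg]

theorem exists_mem_paramSet (S : ModelSpace s H) (κ : ℕ ≃ ℕ × ℕ) (w : Indexation) {M : ℕ → ℝ}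
    (hM : IsAdmissibleBound s w M) (hμ : IsPlaneSolution s μ) :
    ∃ g ∈ S.paramSet κ w M, IsGramFunction (S.family w g) fun p => ∫ x, p.fn x ∂μ := by
  obtain ⟨g, v, b, c, hv, hbc, hg, hgram⟩ := S.exists_triangular_model w hμ
  refine ⟨g, ?_, hgram⟩
  -- The squared norm of g r is the integral of |y_p|² with p = w r, which M bounds by
  -- admissibility.
  have hsq (r : ℕ) : ‖g r‖ ^ 2 ≤ M r := by
    have h1 := hgram (w r).1 (w r).1
    rw [S.family_apply, ip, ← ofReal_norm_sq_eq_inner] at h1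
    have h2 (x : ℝ × ℝ) : ((w r).1.conjAdd (w r).1).fn x = ((‖(w r).1.fn x‖ ^ 2 : ℝ) : ℂ) := by
      rw [fn_conjAdd, Complex.mul_conj, Complex.normSq_eq_norm_sq]
    simp only [h2] at h1
    rw [integral_complex_ofReal, Complex.ofReal_inj] at h1
    rw [h1]
    exact (hM r).2 μ hμ
  have hle (r : ℕ) : ‖g r‖ ≤ Real.sqrt (M r) := Real.le_sqrt_of_sq_le (hsq r)
  have hE := GramEq.holds_of_isGramFunction hμ.isShiftSystem hgram
  have hstep (r : ℕ) : S.Step κ w M r (fun i : Fin (r + 1) => g i) := by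
    refine ⟨?_, fun E _ hsub => (hE E).congr fun p hp =>
      (S.tupleFamily_eq_family w g (r + 1) ?_).symm⟩
    · exact S.exists_step_coefficients κ (hv r) (hbc r).1 (hbc r).2 (hg r) (hsq r)
    · simpa only [Nat.lt_succ_iff] using hsub hp
  refine Set.mem_iInter.2 fun r => ⟨⟨1, ?_⟩, mem_G_iff.2 fun j _ => hstep j, fun j _ => hle j⟩
  rintro _ ⟨j, rfl⟩
  have hpos : 0 < Real.sqrt (M j) := Real.sqrt_pos.2 (hM j).1
  change 1 / Real.sqrt (M j) * ‖g j‖ ≤ 1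
  rw [one_div, inv_mul_le_iff₀ hpos, mul_one]
  exact hle j

end ModelSpace

end PlaneMoments

/-! ### Passage between the plane and ℂ -/

section ComplexMoments

variable {a : ℕ → ℕ → ℂ}

theorem measurable_toComplex : Measurable fun x : ℝ × ℝ => (x.1 : ℂ) + (x.2 : ℂ) * Complex.I := by
  fun_prop

theorem pow_mul_conj_pow_eq (x y : ℝ) (m n : ℕ) :
    ((x : ℂ) + y * Complex.I) ^ m * starRingEnd ℂ ((x : ℂ) + y * Complex.I) ^ n =
      ∑ r ∈ Finset.range (m + 1), ∑ l ∈ Finset.range (n + 1),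
        ((m.choose r : ℂ) * (n.choose l : ℂ) * (-1 : ℂ) ^ (n - l) *
          Complex.I ^ (m - r + (n - l))) * ((x : ℂ) ^ (r + l) * (y : ℂ) ^ (m - r + (n - l))) := by
  have h : starRingEnd ℂ ((x : ℂ) + y * Complex.I) = x + -1 * (y * Complex.I) := by simp
  rw [h, add_pow, add_pow, Finset.sum_mul_sum]
  refine Finset.sum_congr rfl fun r _ => Finset.sum_congr rfl fun l _ => ?_
  simp only [mul_pow, pow_add]
  ring

theorem re_pow_mul_im_pow_eq (z : ℂ) (m n : ℕ) :
    (z.re : ℂ) ^ m * (z.im : ℂ) ^ n =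
      1 / ((2 : ℂ) ^ m * (2 * Complex.I) ^ n) *
        ∑ k ∈ Finset.range (m + 1), ∑ j ∈ Finset.range (n + 1),
          ((-1 : ℂ) ^ (n - j) * (m.choose k : ℂ) * (n.choose j : ℂ)) *
            (z ^ (k + j) * starRingEnd ℂ z ^ (m - k + (n - j))) := by
  have h2 : (2 * Complex.I : ℂ) ≠ 0 := by simp
  have hre : (z.re : ℂ) = (z + starRingEnd ℂ z) / 2 := Complex.re_eq_add_conj z
  have him : (z.im : ℂ) = (z + -1 * starRingEnd ℂ z) / (2 * Complex.I) := by
    rw [Complex.im_eq_sub_conj]; ring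
  rw [hre, him, div_pow, div_pow, add_pow, add_pow, div_mul_div_comm, Finset.sum_mul_sum,
    div_eq_inv_mul, one_div]
  congr 1
  refine Finset.sum_congr rfl fun k _ => Finset.sum_congr rfl fun j _ => ?_
  simp only [mul_pow, pow_add]
  ring

theorem IsPlaneSolution.isComplexSolution {s : ℕ → ℕ → ℂ} {μ : Measure (ℝ × ℝ)}
    (hμ : IsPlaneSolution s μ) : IsComplexSolution (complexMoments s) (toComplexMeasure μ) := by
  intro m n
  have hc : Continuous fun z : ℂ => z ^ m * starRingEnd ℂ z ^ n := by fun_prop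
  have hi (r l : ℕ) (c : ℂ) (k : ℕ) : Integrable (fun x : ℝ × ℝ =>
      c * ((x.1 : ℂ) ^ (r + l) * (x.2 : ℂ) ^ k)) μ := (hμ _ _).1.const_mul _
  rw [toComplexMeasure, integrable_map_measure hc.aestronglyMeasurable
    measurable_toComplex.aemeasurable, integral_map measurable_toComplex.aemeasurable
    hc.aestronglyMeasurable]
  simp only [Function.comp_def, pow_mul_conj_pow_eq]
  refine ⟨integrable_finsetSum _ fun r _ => integrable_finsetSum _ fun l _ => hi _ _ _ _, ?_⟩
  rw [integral_finsetSum _ fun r _ => integrable_finsetSum _ fun l _ => hi _ _ _ _]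
  refine Finset.sum_congr rfl fun r _ => ?_
  rw [integral_finsetSum _ fun l _ => hi _ _ _ _]
  refine Finset.sum_congr rfl fun l _ => ?_
  rw [integral_const_mul, (hμ _ _).2]

/-- A measure on `ℂ` viewed as a measure on the plane. -/
def toPlaneMeasure (σ : Measure ℂ) : Measure (ℝ × ℝ) := σ.map fun z => (z.re, z.im)

theorem measurable_re_im : Measurable fun z : ℂ => (z.re, z.im) :=
  Complex.measurable_re.prodMk Complex.measurable_im

theorem toComplexMeasure_toPlaneMeasure (σ : Measure ℂ) :
    toComplexMeasure (toPlaneMeasure σ) = σ := by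
  rw [toComplexMeasure, toPlaneMeasure, Measure.map_map measurable_toComplex measurable_re_im]
  simp [Function.comp_def, Complex.re_add_im]

theorem IsComplexSolution.isPlaneSolution {σ : Measure ℂ} (hσ : IsComplexSolution a σ) :
    IsPlaneSolution (planeMoments a) (toPlaneMeasure σ) := by
  intro m n
  have hc : Continuous fun x : ℝ × ℝ => (x.1 : ℂ) ^ m * (x.2 : ℂ) ^ n := by fun_prop
  have hi (r l : ℕ) (c : ℂ) (k : ℕ) : Integrable (fun z : ℂ =>
      c * (z ^ (r + l) * starRingEnd ℂ z ^ k)) σ := (hσ _ _).1.const_mul _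
  rw [toPlaneMeasure, integrable_map_measure hc.aestronglyMeasurable
    measurable_re_im.aemeasurable, integral_map measurable_re_im.aemeasurable
    hc.aestronglyMeasurable]
  simp only [Function.comp_def, re_pow_mul_im_pow_eq]
  refine ⟨(integrable_finsetSum _ fun r _ =>
    integrable_finsetSum _ fun l _ => hi _ _ _ _).const_mul _, ?_⟩
  rw [integral_const_mul,
    integral_finsetSum _ fun r _ => integrable_finsetSum _ fun l _ => hi _ _ _ _, planeMoments]
  congr 1
  refine Finset.sum_congr rfl fun r _ => ?_
  rw [integral_finsetSum _ fun l _ => hi _ _ _ _]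
  refine Finset.sum_congr rfl fun l _ => ?_
  rw [integral_const_mul, (hσ _ _).2]

end ComplexMoments

end

end MomentProblem

/-! ### Assembly of the theorem -/

theorem theorem4p2 (a : ℕ → ℕ → ℂ)
    {H : Type*} [NormedAddCommGroup H] [InnerProductSpace ℂ H] [CompleteSpace H]
    (S : ModelSpace (planeMoments a) H) (κ : ℕ ≃ ℕ × ℕ) (w : Indexation) (M : ℕ → ℝ)
    (hM : IsAdmissibleBound (planeMoments a) w M)
    (hpos : IsPositive (planeMoments a))
    (hstep0 : S.StepZero w)
    (hG : (S.paramSet κ w M).Nonempty)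
    (ha : ∀ m n : ℕ, a m n = complexMoments (planeMoments a) m n) :
    {σ | IsComplexSolution a σ} =
        toComplexMeasure '' {μ | IsPlaneSolution (planeMoments a) μ} ∧
    (∀ g ∈ S.paramSet κ w M,
      S.IsExtension w (S.family w g) ∧
      ∀ φ : Omega → ℂ, IsGramFunction (S.family w g) φ →
        (∃! μ, IsExtendedSolution φ μ) ∧
        ∀ μ, IsExtendedSolution φ μ →
          IsPlaneSolution (planeMoments a) μ ∧ IsComplexSolution a (toComplexMeasure μ)) ∧
    {σ | IsComplexSolution a σ} =
      {σ | ∃ g ∈ S.paramSet κ w M, ∃ φ : Omega → ℂ, IsGramFunction (S.family w g) φ ∧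
        ∃ μ, IsExtendedSolution φ μ ∧ σ = toComplexMeasure μ} := by
  have ha' : a = complexMoments (planeMoments a) := funext₂ ha
  have hcomplex {μ : MeasureTheory.Measure (ℝ × ℝ)} (hμ : IsPlaneSolution (planeMoments a) μ) :
      IsComplexSolution a (toComplexMeasure μ) := ha' ▸ hμ.isComplexSolution
  refine ⟨?_, fun g hg => ?_, ?_⟩
  · ext σ
    constructor
    · exact fun hσ => ⟨toPlaneMeasure σ, hσ.isPlaneSolution, toComplexMeasure_toPlaneMeasure σ⟩
    · rintro ⟨μ, hμ, rfl⟩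
      exact hcomplex hμ
  · have hX := ModelSpace.isExtension_family hstep0 hg
    refine ⟨hX, fun φ hφ => ⟨?_, fun μ hμ => ?_⟩⟩
    · obtain ⟨μ, hμ⟩ := exists_isExtendedSolution (hX.isShiftSystem hφ) hφ
      exact ⟨μ, hμ, fun μ' hμ' => hμ'.unique hμ⟩
    · exact ⟨hX.isPlaneSolution hφ hμ, hcomplex (hX.isPlaneSolution hφ hμ)⟩
  · ext σ
    constructor
    · intro hσ
      have hμ := IsComplexSolution.isPlaneSolution hσ
      obtain ⟨g, hg, hgram⟩ := S.exists_mem_paramSet κ w hM hμ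
      -- Here φ consists of the extended moments of the plane measure itself, which therefore solves
      -- the extended problem by definition.
      exact ⟨g, hg, _, hgram, toPlaneMeasure σ, fun p => ⟨hμ.integrable_fn p, rfl⟩,
        (toComplexMeasure_toPlaneMeasure σ).symm⟩
    · rintro ⟨g, hg, φ, hφ, μ, hμ, rfl⟩
      exact hcomplex ((ModelSpace.isExtension_family hstep0 hg).isPlaneSolution hφ hμ)
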